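/- Let $r\ge 1$. For a matroid $M$ on a finite set $E$, a representation over a field $K$ is a map $\rho\colon E\to V$ to a $K$-vector space such that a subset of $E$ is independent iff $\rho$ maps it injectively onto a linearly independent set, and such that $\rho(E)$ spans $V$; $M$ is regular if it is representable over every field. Let $\mathcal R(r,\mathbb F_2)$ be the category of regular matroids $(E,M)$ of rank $r$ on finite sets, whose morphisms $(E_1,M_1)\to(E_2,M_2)$ are the injections $f\colon E_1\to E_2$ such that a subset of $E_1$ is independent iff its image in $E_2$ is. Let $\mathcal G\ell(r,\mathbb F_2)$ be the groupoid of $\mathbb F_2$-vector spaces isomorphic to $\mathbb F_2^r$ and linear isomorphisms. Let $H_1(M)$ be the abelian group generated by $E$ modulo $\sum_{e\in C}e=0$ for all circuits $C$ of $M$, and $H_1(M;\mathbb F_2)=H_1(M)\otimes\mathbb F_2$; this gives a functor $H_1(-;\mathbb F_2)\colon\mathcal R(r,\mathbb F_2)\to\mathcal G\ell(r,\mathbb F_2)$. Let $IR(r,\mathbb F_2)$ be the poset, ordered by inclusion, of all subsets of $\mathbb F_2^r\setminus\{0\}$ which, with their linear matroid structure, are regular matroids of rank $r$. Write $B\mathcal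 C$ for the classifying space of a category $\mathcal C$ (the geometric realization of its nerve), and $|P|=BP$ for a poset $P$. Let $Z$ be any object of $\mathcal G\ell(r,\mathbb F_2)$ (for example $\mathbb F_2^r$). The fiber category $\widetilde{\mathcal R}_Z$ of $H_1(-;\mathbb F_2)$ has as objects the pairs $(M,f)$ with $M$ in $\mathcal R(r,\mathbb F_2)$ and $f\colon Z\to H_1(M;\mathbb F_2)$ an isomorphism, and as morphisms $(M,f)\to(N,g)$ the morphisms $h\colon M\to N$ with $g=H_1(h;\mathbb F_2)\circ f$. Then: 1. $|IR(r,\mathbb F_2)|$ is homotopy equivalent to $B\widetilde{\mathcal R}_Z$. 2. The sequence $$|IR(r,\mathbb F_2)|\to B\mathcal R(r,\mathbb F_2)\to B\mathcal G\ell(r,\mathbb F_2),$$ whose maps are induced by the functor sending a set of vectors to its linear matroid and by $H_1(-;\mathbb F_2)$, is a homotopy fiber sequence over the vertex $Z$: there is a homotopy from the composite to the constant map at $Z$ such that the induced map from $|IR(r,\mathbb F_2)|$ to the homotopy fiber over $Z$ of the second map (the space of pairs of a point $x$ of $B\mathcal R(r,\mathbb F_2)$ and a path from the image of $x$ to $Z$)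 is a homotopy equivalence. -/

import Mathlib

open CategoryTheory

namespace RegMatroid

/-! ### Linear representations of matroids and regular matroids

A matroid on a finite set `E` is a Mathlib matroid on the type `E` whose ground set is `Set.univ`. -/

section Representations

variable {E : Type} {K : Type} [Field K] {V : Type} [AddCommGroup V] [Module K V]

/-- `ρ : E → V` represents `M`: a subset `I` of `E` is independent iff `ρ` is injective on `I` and
maps it onto a linearly independent set (this is `LinearIndepOn K ρ I`), and the image of `ρ`
spans `V`. -/
def IsRepresentation (K : Type) [Field K] {V : Type} [AddCommGroup V] [Module K V]
    (M : Matroid E) (ρ : E → V) : Prop :=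
  (∀ I : Set E, M.Indep I ↔ LinearIndepOn K ρ I) ∧ Submodule.span K (Set.range ρ) = ⊤

/-- `M` is representable over the field `K`. -/
def IsRepresentable (K : Type) [Field K] (M : Matroid E) : Prop :=
  ∃ (V : Type) (_ : AddCommGroup V) (_ : Module K V) (ρ : E → V), IsRepresentation K M ρ

/-- A matroid is regular if it is representable over every field. -/
def IsRegular (M : Matroid E) : Prop :=
  ∀ (K : Type) [Field K], IsRepresentable K M

theorem linearIndepOn_augment {ρ : E → V} {I J : Set E} (hI : LinearIndepOn K ρ I)
    (hJ : LinearIndepOn K ρ J) (hIJ : I.encard < J.encard) :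
    ∃ e ∈ J, e ∉ I ∧ LinearIndepOn K ρ (insert e I) := by
  by_contra! hcon
  have hsub : ∀ e ∈ J, ρ e ∈ Submodule.span K (ρ '' I) := by
    intro e he
    by_cases heI : e ∈ I
    · exact Submodule.subset_span ⟨e, heI, rfl⟩
    · by_contra hns
      exact hcon e he heI (hI.insert hns)
  have hfinI : I.Finite := Set.finite_of_encard_le_coe (k := I.encard.toNat) (by
    rw [ENat.natCast_toNat (ne_top_of_lt hIJ)])
  have h1 : (ρ '' J).encard ≤ (ρ '' I).encard := by
    have hle : Submodule.span K (ρ '' J) ≤ Submodule.span K (ρ '' I) := by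
      rw [Submodule.span_le]
      rintro _ ⟨e, he, rfl⟩
      exact hsub e he
    have hr := Submodule.rank_mono hle
    rw [rank_span_set hJ.id_image, rank_span_set hI.id_image] at hr
    exact Cardinal.toENat.monotone' hr
  rw [hJ.injOn.encard_image, hI.injOn.encard_image] at h1
  exact absurd hIJ (not_lt.mpr h1)

theorem linearIndepOn_comp_iff {E' : Type} {ρ : E → V} {j : E' → E} (hj : Function.Injective j)
    (I : Set E') : LinearIndepOn K (ρ ∘ j) I ↔ LinearIndepOn K ρ (j '' I) := by
  have h : Function.Injective (fun x : I => (⟨j x, x, x.2, rfl⟩ : (j '' I : Set E))) :=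
    fun x y hxy => Subtype.ext (hj (congrArg Subtype.val hxy))
  have h' : Function.Surjective (fun x : I => (⟨j x, x, x.2, rfl⟩ : (j '' I : Set E))) := by
    rintro ⟨_, x, hx, rfl⟩
    exact ⟨⟨x, hx⟩, rfl⟩
  exact linearIndependent_equiv (R := K) (Equiv.ofBijective _ ⟨h, h'⟩)
    (f := fun y : (j '' I : Set E) => ρ y)

/-- The linear matroid on `E` defined by a family `ρ : E → V` of vectors. -/
def linearMatroid (K : Type) [Field K] {V : Type} [AddCommGroup V] [Module K V] [Finite E]
    (ρ : E → V) : Matroid E :=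
  (IndepMatroid.ofFinite (E := Set.univ) Set.finite_univ (fun I => LinearIndepOn K ρ I)
    (linearIndepOn_empty K ρ)
    (fun _ _ hJ hIJ => hJ.mono hIJ)
    (fun I J hI hJ hIJ => linearIndepOn_augment hI hJ (by
      rwa [← (Set.toFinite I).cast_ncard_eq, ← (Set.toFinite J).cast_ncard_eq, Nat.cast_lt]))
    (fun I _ => Set.subset_univ I)).matroid

@[simp] theorem linearMatroid_ground [Finite E] (ρ : E → V) :
    (linearMatroid K ρ).E = Set.univ := rfl

@[simp] theorem linearMatroid_indep [Finite E] (ρ : E → V) (I : Set E) :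
    (linearMatroid K ρ).Indep I ↔ LinearIndepOn K ρ I := Iff.rfl

end Representations

/-! ### The category of regular matroids of rank `r` -/

/-- Objects of the category `R(r, 𝔽₂)`: a finite set `E` with a regular matroid of rank `r`. -/
structure RegularMatroid (r : ℕ) : Type 1 where
  E : Type
  finite : Finite E
  M : Matroid E
  ground : M.E = Set.univ
  rank : M.eRank = r
  regular : IsRegular M

attribute [instance] RegularMatroid.finite

namespace RegularMatroid

variable {r : ℕ}

/-- Morphisms: injective maps `f` such that a set is independent iff its image is. (All morphism
sets are placed in `Type 1`, so that every category below is a small category in `Type 1`.) -/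
@[ext]
structure Hom (A B : RegularMatroid r) : Type 1 where
  toFun : A.E → B.E
  injective : Function.Injective toFun
  indep_iff : ∀ I : Set A.E, A.M.Indep I ↔ B.M.Indep (toFun '' I)

instance : SmallCategory (RegularMatroid r) where
  Hom := Hom
  id A := ⟨id, Function.injective_id, fun I => by rw [Set.image_id]⟩
  comp f g := ⟨g.toFun ∘ f.toFun, g.injective.comp f.injective, fun I => by
    rw [f.indep_iff, g.indep_iff, Set.image_comp]⟩

@[simp] theorem id_toFun (A : RegularMatroid r) : (𝟙 A : Hom A A).toFun = id := rfl

@[simp] theorem comp_toFun {A B C : RegularMatroid r} (f : A ⟶ B) (g : B ⟶ C) :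
    (f ≫ g : Hom A C).toFun = g.toFun ∘ f.toFun := rfl

end RegularMatroid

/-! ### The groupoid `Gℓ(r, 𝔽₂)` -/

/-- Objects of the groupoid `Gℓ(r, 𝔽₂)`: vector spaces over `𝔽₂` isomorphic to `𝔽₂ʳ`. -/
structure GL2 (r : ℕ) : Type 1 where
  V : Type
  [addCommGroup : AddCommGroup V]
  [module : Module (ZMod 2) V]
  nonempty_equiv : Nonempty (V ≃ₗ[ZMod 2] (Fin r → ZMod 2))

attribute [instance] GL2.addCommGroup GL2.module

namespace GL2

variable {r : ℕ}

/-- Morphisms: linear isomorphisms. -/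
@[ext]
structure Hom (V W : GL2 r) : Type 1 where
  toEquiv : V.V ≃ₗ[ZMod 2] W.V

instance : Groupoid (GL2 r) where
  Hom := Hom
  id V := ⟨LinearEquiv.refl _ _⟩
  comp f g := ⟨f.toEquiv.trans g.toEquiv⟩
  inv f := ⟨f.toEquiv.symm⟩
  inv_comp f := Hom.ext (LinearEquiv.ext fun x => f.toEquiv.apply_symm_apply x)
  comp_inv f := Hom.ext (LinearEquiv.ext fun x => f.toEquiv.symm_apply_apply x)

end GL2

/-! ### First homology of a matroid -/

section Homology

open TensorProduct

variable {E : Type} {r : ℕ}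

/-- The subgroup of relations `∑ e ∈ C, e = 0`, for all circuits `C` of `M`. -/
noncomputable def circuitRelations (M : Matroid E) : Submodule ℤ (E →₀ ℤ) :=
  Submodule.span ℤ {x | ∃ C : Finset E, M.IsCircuit (C : Set E) ∧
    x = ∑ e ∈ C, Finsupp.single e 1}

/-- `H₁(M)`: the abelian group generated by `E` modulo `∑ e ∈ C, e = 0` for all circuits `C`. -/
noncomputable abbrev H1 (M : Matroid E) : Type := (E →₀ ℤ) ⧸ circuitRelations M

/-- `H₁(M; 𝔽₂) = 𝔽₂ ⊗ H₁(M)`, a vector space over `𝔽₂`. -/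
noncomputable abbrev H1F2 (M : Matroid E) : Type := ZMod 2 ⊗[ℤ] H1 M

/-- The class in `H₁(M)` of an element of `E`. -/
noncomputable def H1.of (M : Matroid E) (e : E) : H1 M := (circuitRelations M).mkQ (Finsupp.single e 1)

/-- The universal cocycle `E → H₁(M; 𝔽₂)`. -/
noncomputable def H1F2.of (M : Matroid E) (e : E) : H1F2 M := 1 ⊗ₜ H1.of M e

theorem H1.sum_circuit {M : Matroid E} {C : Finset E} (hC : M.IsCircuit (C : Set E)) :
    ∑ e ∈ C, H1.of M e = 0 := by
  simp only [H1.of]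
  rw [← map_sum, Submodule.mkQ_apply, Submodule.Quotient.mk_eq_zero]
  exact Submodule.subset_span ⟨C, hC, rfl⟩

theorem H1F2.sum_circuit {M : Matroid E} {C : Finset E} (hC : M.IsCircuit (C : Set E)) :
    ∑ e ∈ C, H1F2.of M e = 0 := by
  simp only [H1F2.of]
  rw [← TensorProduct.tmul_sum, H1.sum_circuit hC, TensorProduct.tmul_zero]

theorem H1F2.span_of (M : Matroid E) :
    Submodule.span (ZMod 2) (Set.range (H1F2.of M)) = ⊤ := by
  rw [eq_top_iff]
  rintro x -
  induction x using TensorProduct.induction_on with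
  | zero => exact Submodule.zero_mem _
  | add x y hx hy => exact Submodule.add_mem _ hx hy
  | tmul a y =>
    obtain ⟨f, rfl⟩ := (circuitRelations M).mkQ_surjective y
    have key : ∀ f : E →₀ ℤ, (1 : ZMod 2) ⊗ₜ[ℤ] (circuitRelations M).mkQ f ∈
        Submodule.span (ZMod 2) (Set.range (H1F2.of M)) := by
      intro f
      induction f using Finsupp.induction_linear with
      | zero => rw [map_zero, TensorProduct.tmul_zero]; exact Submodule.zero_mem _
      | add f g hf hg => rw [map_add, TensorProduct.tmul_add]; exact Submodule.add_mem _ hf hg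
      | single e n =>
        have : (Finsupp.single e n : E →₀ ℤ) = n • Finsupp.single e 1 := by simp
        rw [this, map_smul, TensorProduct.tmul_smul]
        have he : H1F2.of M e ∈ Submodule.span (ZMod 2) (Set.range (H1F2.of M)) :=
          Submodule.subset_span ⟨e, rfl⟩
        exact zsmul_mem he n
    have : a ⊗ₜ[ℤ] (circuitRelations M).mkQ f =
        a • ((1 : ZMod 2) ⊗ₜ[ℤ] (circuitRelations M).mkQ f) := by
      rw [TensorProduct.smul_tmul', smul_eq_mul, mul_one]
    rw [this]
    exact Submodule.smul_mem _ _ (key f)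

theorem H1F2.span_base [Finite E] {M : Matroid E} (hE : M.E = Set.univ) {B : Set E}
    (hB : M.IsBase B) :
    Submodule.span (ZMod 2) (H1F2.of M '' B) = ⊤ := by
  classical
  rw [eq_top_iff, ← H1F2.span_of M, Submodule.span_le]
  rintro _ ⟨e, rfl⟩
  by_cases he : e ∈ B
  · exact Submodule.subset_span ⟨e, he, rfl⟩
  have hC := hB.fundCircuit_isCircuit (x := e) (by rw [hE]; trivial) he
  set C : Finset E := (Set.toFinite (M.fundCircuit e B)).toFinset with hCdef
  have hCC : (C : Set E) = M.fundCircuit e B := by simp [hCdef]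
  have hsum := H1F2.sum_circuit (M := M) (C := C) (by rw [hCC]; exact hC)
  have heC : e ∈ C := by
    rw [← Finset.mem_coe, hCC]; exact M.mem_fundCircuit e B
  rw [← Finset.add_sum_erase C _ heC] at hsum
  rw [SetLike.mem_coe, eq_neg_of_add_eq_zero_left hsum]
  refine Submodule.neg_mem _ (Submodule.sum_mem _ fun x hx => Submodule.subset_span ⟨x, ?_, rfl⟩)
  rw [Finset.mem_erase] at hx
  have : x ∈ insert e B := M.fundCircuit_subset_insert e B (by
    rw [← hCC]; exact hx.2)
  exact this.resolve_left hx.1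

theorem sum_circuit_representation {V : Type} [AddCommGroup V] [Module (ZMod 2) V]
    {M : Matroid E} {ρ : E → V}
    (hρ : ∀ I : Set E, M.Indep I ↔ LinearIndepOn (ZMod 2) ρ I)
    {C : Finset E} (hC : M.IsCircuit (C : Set E)) : ∑ e ∈ C, ρ e = 0 := by
  classical
  have hdep : ¬ LinearIndepOn (ZMod 2) ρ (C : Set E) := fun h => hC.not_indep ((hρ _).2 h)
  rw [linearIndepOn_finset_iff] at hdep
  push Not at hdep
  obtain ⟨g, hg, i, hi, hgi⟩ := hdep
  set D : Finset E := C.filter (fun e => g e ≠ 0) with hD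
  have hDC : (D : Set E) ⊆ C := by
    intro x hx; exact (Finset.mem_filter.1 hx).1
  have hDsum : ∑ e ∈ D, g e • ρ e = 0 := by
    rw [hD, Finset.sum_filter_of_ne]
    · exact hg
    · intro x _ hx h0
      exact hx (by rw [h0, zero_smul])
  have hDdep : ¬ M.Indep (D : Set E) := by
    rw [hρ, linearIndepOn_finset_iff]
    push Not
    exact ⟨g, hDsum, i, Finset.mem_filter.2 ⟨hi, hgi⟩, hgi⟩
  have hDC' : D = C := by
    have := hC.eq_of_not_indep_subset hDdep hDC
    exact_mod_cast this
  have hone : ∀ e ∈ C, g e = 1 := by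
    intro e he
    rw [← hDC'] at he
    have h := (Finset.mem_filter.1 he).2
    generalize g e = a at h
    revert a
    decide
  rw [← hg]
  exact Finset.sum_congr rfl fun e he => by rw [hone e he, one_smul]

/-- The linear map `H₁(M; 𝔽₂) → V` induced by a function that vanishes on circuits. -/
noncomputable def H1F2.lift {V : Type} [AddCommGroup V] [Module (ZMod 2) V] (M : Matroid E)
    (ρ : E → V) (hρ : ∀ C : Finset E, M.IsCircuit (C : Set E) → ∑ e ∈ C, ρ e = 0) :
    H1F2 M →ₗ[ZMod 2] V :=
  TensorProduct.AlgebraTensorModule.lift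
    (LinearMap.toSpanSingleton (ZMod 2) (H1 M →ₗ[ℤ] V)
      ((circuitRelations M).liftQ (Finsupp.linearCombination ℤ ρ) (by
        rw [circuitRelations, Submodule.span_le]
        rintro _ ⟨C, hC, rfl⟩
        simp [hρ C hC])))

@[simp] theorem H1F2.lift_of {V : Type} [AddCommGroup V] [Module (ZMod 2) V] (M : Matroid E)
    (ρ : E → V) (hρ : ∀ C : Finset E, M.IsCircuit (C : Set E) → ∑ e ∈ C, ρ e = 0) (e : E) :
    H1F2.lift M ρ hρ (H1F2.of M e) = ρ e := by
  simp [H1F2.lift, H1F2.of, H1.of]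

theorem H1F2.linearIndepOn_base {M : Matroid E}
    (hM : IsRepresentable (ZMod 2) M) {B : Set E} (hB : M.IsBase B) :
    LinearIndepOn (ZMod 2) (H1F2.of M) B := by
  obtain ⟨V, _, _, ρ, hρ, -⟩ := hM
  have h := (hρ B).1 hB.indep
  refine LinearIndepOn.of_comp
    (H1F2.lift M ρ fun C hC => sum_circuit_representation hρ hC) ?_
  convert h using 1
  ext e
  simp

theorem H1F2.nonempty_equiv (A : RegularMatroid r) :
    Nonempty (H1F2 A.M ≃ₗ[ZMod 2] (Fin r → ZMod 2)) := by
  obtain ⟨B, hB⟩ := A.M.exists_isBase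
  have hli := H1F2.linearIndepOn_base (A.regular (ZMod 2)) hB
  have hsp := H1F2.span_base A.ground hB
  have hcard : Nat.card B = r := by
    have h := hB.encard_eq_eRank
    rw [A.rank, ← (Set.toFinite B).cast_ncard_eq] at h
    rw [Nat.card_coe_set_eq]
    exact_mod_cast h
  have b : Module.Basis B (ZMod 2) (H1F2 A.M) :=
    Module.Basis.mk hli (by
      rw [← hsp]
      apply Submodule.span_mono
      rintro _ ⟨e, he, rfl⟩
      exact ⟨⟨e, he⟩, rfl⟩)
  exact ⟨(b.reindex ((Finite.equivFin B).trans (finCongr hcard))).equivFun⟩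

theorem RegularMatroid.Hom.isCircuit_image {A B : RegularMatroid r} (f : A ⟶ B) {C : Set A.E}
    (hC : A.M.IsCircuit C) : B.M.IsCircuit (f.toFun '' C) := by
  rw [Matroid.isCircuit_iff_minimal_not_indep (by rw [B.ground]; exact Set.subset_univ _)]
  refine ⟨fun h => hC.not_indep ((f.indep_iff C).2 h), fun D hD hDC => ?_⟩
  obtain ⟨D', hD', rfl⟩ := Set.subset_image_iff.1 hDC
  have := hC.eq_of_not_indep_subset (fun h => hD ((f.indep_iff D').1 h)) hD'
  rw [this]

theorem RegularMatroid.Hom.isBase_image {A B : RegularMatroid r} (f : A ⟶ B) {I : Set A.E}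
    (hI : A.M.IsBase I) : B.M.IsBase (f.toFun '' I) := by
  have hind := (f.indep_iff I).1 hI.indep
  obtain ⟨J, hJ, hIJ⟩ := hind.exists_isBase_superset
  have h1 : (f.toFun '' I).encard = J.encard := by
    rw [f.injective.encard_image, hI.encard_eq_eRank, hJ.encard_eq_eRank, A.rank, B.rank]
  have heq : f.toFun '' I = J := (Set.toFinite _).eq_of_subset_of_encard_le hIJ h1.ge
  rw [heq]
  exact hJ

/-- The map induced on `H₁(-)` by a morphism of matroids: `[e] ↦ [f e]`. -/
noncomputable def H1.map {A B : RegularMatroid r} (f : A ⟶ B) : H1 A.M →ₗ[ℤ] H1 B.M :=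
  (circuitRelations A.M).mapQ (circuitRelations B.M) (Finsupp.lmapDomain ℤ ℤ f.toFun) (by
    classical
    rw [circuitRelations, Submodule.span_le]
    rintro _ ⟨C, hC, rfl⟩
    refine Submodule.subset_span ⟨C.image f.toFun, ?_, ?_⟩
    · rw [Finset.coe_image]; exact RegularMatroid.Hom.isCircuit_image f hC
    · rw [Finset.sum_image (fun _ _ _ _ h => f.injective h), map_sum]
      simp)

@[simp] theorem H1.map_of {A B : RegularMatroid r} (f : A ⟶ B) (e : A.E) :
    H1.map f (H1.of A.M e) = H1.of B.M (f.toFun e) := by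
  simp [H1.map, H1.of]

/-- The map induced on `H₁(-; 𝔽₂)` by a morphism of matroids. -/
noncomputable def H1F2.map {A B : RegularMatroid r} (f : A ⟶ B) :
    H1F2 A.M →ₗ[ZMod 2] H1F2 B.M :=
  (H1.map f).baseChange (ZMod 2)

@[simp] theorem H1F2.map_of {A B : RegularMatroid r} (f : A ⟶ B) (e : A.E) :
    H1F2.map f (H1F2.of A.M e) = H1F2.of B.M (f.toFun e) := by
  simp [H1F2.map, H1F2.of]

theorem H1F2.map_bijective {A B : RegularMatroid r} (f : A ⟶ B) :
    Function.Bijective (H1F2.map f) := by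
  obtain ⟨eA⟩ := H1F2.nonempty_equiv A
  obtain ⟨eB⟩ := H1F2.nonempty_equiv B
  have hsurj : Function.Surjective (H1F2.map f) := by
    obtain ⟨I, hI⟩ := A.M.exists_isBase
    rw [← LinearMap.range_eq_top, eq_top_iff,
      ← H1F2.span_base B.ground (RegularMatroid.Hom.isBase_image f hI), Submodule.span_le]
    rintro _ ⟨_, ⟨e, -, rfl⟩, rfl⟩
    exact ⟨H1F2.of A.M e, H1F2.map_of f e⟩
  have : Module.Finite (ZMod 2) (H1F2 A.M) := Module.Finite.equiv eA.symm
  have : Module.Finite (ZMod 2) (H1F2 B.M) := Module.Finite.equiv eB.symm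
  refine ⟨?_, hsurj⟩
  rwa [LinearMap.injective_iff_surjective_of_finrank_eq_finrank
    (eA.trans eB.symm).finrank_eq]

/-- The mod-2 homology functor `H₁(-; 𝔽₂) : R(r, 𝔽₂) ⥤ Gℓ(r, 𝔽₂)`. -/
noncomputable def homologyFunctor (r : ℕ) : RegularMatroid r ⥤ GL2 r where
  obj A := ⟨H1F2 A.M, H1F2.nonempty_equiv A⟩
  map f := ⟨LinearEquiv.ofBijective (H1F2.map f) (H1F2.map_bijective f)⟩
  map_id A := by
    refine GL2.Hom.ext (LinearEquiv.toLinearMap_injective ?_)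
    refine LinearMap.ext_on_range (H1F2.span_of A.M) fun e => ?_
    exact H1F2.map_of (𝟙 A) e
  map_comp {A B C} f g := by
    refine GL2.Hom.ext (LinearEquiv.toLinearMap_injective ?_)
    refine LinearMap.ext_on_range (H1F2.span_of A.M) fun e => ?_
    change H1F2.map (f ≫ g) (H1F2.of A.M e) = H1F2.map g (H1F2.map f (H1F2.of A.M e))
    rw [H1F2.map_of, H1F2.map_of, H1F2.map_of]
    rfl

end Homology

/-- The fiber category of `H₁(-; 𝔽₂)` over an object `Z` of the groupoid `Gℓ(r, 𝔽₂)`: objects are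
pairs `(A, f)` with `A` a regular matroid of rank `r` and `f : Z ⟶ H₁(A; 𝔽₂)` a (necessarily
invertible) morphism; a morphism `(A, f) ⟶ (B, g)` is a morphism `h : A ⟶ B` with
`f ≫ H₁(h; 𝔽₂) = g`. -/
abbrev FiberCategory (r : ℕ) (Z : GL2 r) : Type 1 := StructuredArrow Z (homologyFunctor r)

/-! ### The fiber poset -/

/-- The set `IR(r, 𝔽₂)` of subsets `S` of `𝔽₂ʳ \ 0` which, with the linear matroid structure, are
regular matroids of rank `r`. -/
@[ext]
structure IR (r : ℕ) : Type 1 where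
  carrier : Set (Fin r → ZMod 2)
  zero_notMem : 0 ∉ carrier
  rank : (linearMatroid (ZMod 2) (Subtype.val : carrier → Fin r → ZMod 2)).eRank = r
  regular : IsRegular (linearMatroid (ZMod 2) (Subtype.val : carrier → Fin r → ZMod 2))

namespace IR

variable {r : ℕ}

/-- `IR(r, 𝔽₂)` is ordered by inclusion. As every preorder, it is also regarded as a category. -/
instance : PartialOrder (IR r) := PartialOrder.lift IR.carrier (fun _ _ h => IR.ext h)

/-- An element of `IR(r, 𝔽₂)` as a regular matroid. -/
def toRegularMatroid (S : IR r) : RegularMatroid r where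
  E := S.carrier
  finite := inferInstance
  M := linearMatroid (ZMod 2) (Subtype.val : S.carrier → Fin r → ZMod 2)
  ground := rfl
  rank := S.rank
  regular := S.regular

/-- The functor `IR(r, 𝔽₂) ⥤ R(r, 𝔽₂)` sending a set of vectors to its linear matroid and an
inclusion of sets to the inclusion map. -/
def inclusionFunctor (r : ℕ) : IR r ⥤ RegularMatroid r where
  obj := toRegularMatroid
  map {S T} h :=
    { toFun := Set.inclusion (show S.carrier ⊆ T.carrier from
        (leOfHom h : S ≤ T))
      injective := Set.inclusion_injective _
      indep_iff := fun I => by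
        exact linearIndepOn_comp_iff
          (ρ := (Subtype.val : T.carrier → Fin r → ZMod 2)) (Set.inclusion_injective _) I }
  map_id _ := rfl
  map_comp _ _ := rfl

end IR

/-! ### Classifying spaces and homotopy fiber sequences -/

section Topology

universe u v

/-- The classifying space of a small category: the geometric realization of its nerve. For a poset
this is the geometric realization of the poset. -/
noncomputable abbrev classifyingSpace (C : Type u) [SmallCategory C] : TopCat.{u} :=
  SSet.toTop.obj (nerve C)

/-- The continuous map of classifying spaces induced by a functor. -/
noncomputable def classifyingMap {C D : Type u} [SmallCategory C] [SmallCategory D] (F : C ⥤ D) :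
    C(classifyingSpace C, classifyingSpace D) :=
  (SSet.toTop.map (nerveMap F)).hom

/-- The vertex of the classifying space of `C` given by an object of `C`. -/
noncomputable def vertex {C : Type u} [SmallCategory C] (X : C) : classifyingSpace C :=
  TopCat.toSSetObj₀Equiv ((sSetTopAdj.unit.app (nerve C)).app _ (ComposableArrows.mk₀ X))

/-- The homotopy fiber of `p` over `y`: pairs of a point `x` and a path from `p x` to `y`. -/
def HomotopyFiber {X : Type u} {Y : Type v} [TopologicalSpace X] [TopologicalSpace Y]
    (p : C(X, Y)) (y : Y) : Type (max u v) :=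
  {q : X × C(unitInterval, Y) // q.2 0 = p q.1 ∧ q.2 1 = y}

instance {X : Type u} {Y : Type v} [TopologicalSpace X] [TopologicalSpace Y]
    (p : C(X, Y)) (y : Y) : TopologicalSpace (HomotopyFiber p y) :=
  inferInstanceAs (TopologicalSpace {q : X × C(unitInterval, Y) // q.2 0 = p q.1 ∧ q.2 1 = y})

/-- The map to the homotopy fiber of `p` over `y` determined by `i : F → X` together with a
homotopy from `p ∘ i` to the constant map at `y`. -/
def toHomotopyFiber {F X Y : Type*} [TopologicalSpace F] [TopologicalSpace X] [TopologicalSpace Y]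
    (i : C(F, X)) (p : C(X, Y)) (y : Y)
    (H : (p.comp i).Homotopy (ContinuousMap.const F y)) : C(F, HomotopyFiber p y) where
  toFun a := ⟨(i a, (H.toContinuousMap.comp ContinuousMap.prodSwap).curry a),
    H.apply_zero a, H.apply_one a⟩
  continuous_toFun := Continuous.subtype_mk (by fun_prop) _

/-- `f` is a homotopy equivalence. -/
def IsHomotopyEquivalence {X Y : Type*} [TopologicalSpace X] [TopologicalSpace Y]
    (f : C(X, Y)) : Prop :=
  ∃ e : ContinuousMap.HomotopyEquiv X Y, e.toFun = f

/-- `F --i--> X --p--> Y` is a homotopy fiber sequence over the point `y` of `Y`: there is a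
homotopy from `p ∘ i` to the constant map at `y` for which the induced map from `F` to the homotopy
fiber of `p` over `y` is a homotopy equivalence. -/
def IsHomotopyFiberSequence {F X Y : Type*} [TopologicalSpace F] [TopologicalSpace X]
    [TopologicalSpace Y] (i : C(F, X)) (p : C(X, Y)) (y : Y) : Prop :=
  ∃ H : (p.comp i).Homotopy (ContinuousMap.const F y),
    IsHomotopyEquivalence (toHomotopyFiber i p y H)

end Topology

end RegMatroid

open RegMatroid

/-! Two independent facts give the theorem.

For every regular matroid `M` of rank `r` the universal map `E → H₁(M; 𝔽₂)` is itself a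
representation of `M` (`H1F2.indep_iff`). An isomorphism of `Z` with `H₁(M; 𝔽₂)` therefore amounts,
in coordinates, to a spanning configuration of vectors of `𝔽₂ʳ` indexed by `E` and representing `M`,
and morphisms of the fiber category are the injections preserving these vectors
(`FiberCategory.vec_map`, `FiberCategory.homMk`). Such a configuration differs from a set of nonzero
vectors only by loops and parallel elements. Forgetting these (`supportFunctor`) is a homotopy
inverse of `ofIR`. On the fiber category there is in general no morphism between an object and its
support, but both embed naturally in their union, the thickening. This gives a zigzag of natural
transformations, and natural transformations induce homotopies.

For a functor `F : C ⥤ G` to a connected groupoid, the classifying space of the fiber category is a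
principal `Aut Z`-covering of that of `C` (`isQuotientCoveringMap_fiberProj`). By equivariance it is
the pullback of the covering of `BG` by the classifying space of the arrows out of `Z`, which
contracts to its initial object `𝟙 Z`. Path lifting identifies the pullback of a contractible
covering with the homotopy fiber (`isHomotopyEquivalence_toHomotopyFiber`). Precomposition with the
equivalence `ofIR` replaces the fiber category by `IR r`.

The topology is explicit. A point of a simplex is recorded by its partial sums, so that a point of
`BC` becomes a step function on `[0, 1]` with values in the objects of `C`. Inserting one more
breakpoint triangulates the prism and yields the homotopies. Measuring the time spent in a class of
objects yields continuous functions, and these show that the action is a covering action. -/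

namespace RegMatroid

/-! ### Classifying spaces through their cells -/

section Cells

universe u

open Simplicial Opposite

variable {C D : Type u} [SmallCategory C] [SmallCategory D]

/-- The characteristic map of a simplex of the nerve. -/
noncomputable def cell {n : ℕ} (σ : Fin (n + 1) ⥤ C) :
    C(stdSimplex ℝ (Fin (n + 1)), classifyingSpace C) :=
  TopCat.toSSetObjEquiv _ (op ⦋n⦌) ((sSetTopAdj.unit.app (nerve C)).app (op ⦋n⦌) σ)

theorem cell_map {m n : ℕ} (f : Fin (m + 1) →o Fin (n + 1)) (σ : Fin (n + 1) ⥤ C)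
    (t : stdSimplex ℝ (Fin (m + 1))) :
    cell σ (stdSimplex.map f t) = cell (f.monotone.functor ⋙ σ) t := by
  have h := congr($((sSetTopAdj.unit.app (nerve C)).naturality (SimplexCategory.mkHom f).op) σ)
  have h2 := congrArg (fun z => TopCat.toSSetObjEquiv _ (op ⦋m⦌) z t) h
  exact h2.symm

theorem vertex_eq_cell (X : C) (t : stdSimplex ℝ (Fin 1)) :
    vertex X = cell (ComposableArrows.mk₀ X) t := by
  rw [Subsingleton.elim t default]
  rfl

theorem classifyingMap_cell (F : C ⥤ D) {n : ℕ} (σ : Fin (n + 1) ⥤ C)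
    (t : stdSimplex ℝ (Fin (n + 1))) :
    classifyingMap F (cell σ t) = cell (σ ⋙ F) t := by
  have h := congr(($(sSetTopAdj.unit.naturality (nerveMap F))).app (op ⦋n⦌) σ)
  have h2 := congrArg (fun z => TopCat.toSSetObjEquiv _ (op ⦋n⦌) z t) h
  exact h2.symm

/-- A natural family of maps on cells. -/
structure CellFamily (C : Type u) [SmallCategory C] (T : Type*) [TopologicalSpace T] where
  toFun : ∀ {n : ℕ} (_ : Fin (n + 1) ⥤ C), C(stdSimplex ℝ (Fin (n + 1)), T)
  map : ∀ {m n : ℕ} (f : Fin (m + 1) →o Fin (n + 1)) (σ : Fin (n + 1) ⥤ C)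
    (t : stdSimplex ℝ (Fin (m + 1))),
    toFun σ (stdSimplex.map f t) = toFun (f.monotone.functor ⋙ σ) t

variable {T : Type u} [TopologicalSpace T]

/-- The morphism to the singular simplicial set given by a natural family of maps on cells. -/
noncomputable def CellFamily.toSing (φ : CellFamily C T) :
    nerve C ⟶ TopCat.toSSet.obj (TopCat.of T) where
  app n := ↾fun σ => (TopCat.toSSetObjEquiv (TopCat.of T) n).symm (φ.toFun (n := n.unop.len) σ)
  naturality {m n} f := by
    ext σ
    apply (TopCat.toSSetObjEquiv (TopCat.of T) n).injective
    ext t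
    exact (φ.map f.unop.toOrderHom σ t).symm

/-- The continuous map on the classifying space given by a natural family of maps on cells. -/
noncomputable def CellFamily.desc (φ : CellFamily C T) : C(classifyingSpace C, T) :=
  ((sSetTopAdj.homEquiv (nerve C) (TopCat.of T)).symm φ.toSing).hom

theorem CellFamily.desc_cell (φ : CellFamily C T) {n : ℕ} (σ : Fin (n + 1) ⥤ C)
    (t : stdSimplex ℝ (Fin (n + 1))) : φ.desc (cell σ t) = φ.toFun σ t := by
  have h := (sSetTopAdj.homEquiv (nerve C) (TopCat.of T)).apply_symm_apply φ.toSing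
  rw [Adjunction.homEquiv_unit] at h
  have h1 := congr(($h).app (op ⦋n⦌) σ)
  exact congrArg (fun z => TopCat.toSSetObjEquiv _ (op ⦋n⦌) z t) h1

theorem continuousMap_ext_cell {T : Type u} [TopologicalSpace T] {f g : C(classifyingSpace C, T)}
    (h : ∀ (n : ℕ) (σ : Fin (n + 1) ⥤ C) (t : stdSimplex ℝ (Fin (n + 1))),
      f (cell σ t) = g (cell σ t)) : f = g := by
  have : TopCat.ofHom f = TopCat.ofHom g := by
    apply (sSetTopAdj.homEquiv (nerve C) (TopCat.of T)).injective
    rw [Adjunction.homEquiv_unit, Adjunction.homEquiv_unit]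
    ext n σ
    apply (TopCat.toSSetObjEquiv (TopCat.of T) n).injective
    ext t
    exact h _ σ t
  exact congrArg TopCat.Hom.hom this

/-- A continuous map is determined by its restriction to cells. With an indiscrete target every
predicate is continuous, so "lies in a cell" equals the predicate that is always true. -/
theorem exists_cell (x : classifyingSpace C) :
    ∃ (n : ℕ) (σ : Fin (n + 1) ⥤ C) (t : stdSimplex ℝ (Fin (n + 1))), x = cell σ t := by
  let _ : TopologicalSpace (ULift.{u} Prop) := ⊤
  let f : C(classifyingSpace C, ULift.{u} Prop) :=
    ⟨fun x => ⟨∃ (n : ℕ) (σ : Fin (n + 1) ⥤ C) (t : stdSimplex ℝ (Fin (n + 1))), x = cell σ t⟩,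
      continuous_top⟩
  let g : C(classifyingSpace C, ULift.{u} Prop) := ⟨fun _ => ⟨True⟩, continuous_top⟩
  have h : f = g := continuousMap_ext_cell fun n σ t => ULift.ext _ _ (eq_true ⟨n, σ, t, rfl⟩)
  exact of_eq_true (congrArg ULift.down (DFunLike.congr_fun h x))

theorem classifyingMap_comp {E : Type u} [SmallCategory E] (F : C ⥤ D) (G : D ⥤ E) :
    classifyingMap (F ⋙ G) = (classifyingMap G).comp (classifyingMap F) :=
  continuousMap_ext_cell fun n σ t => by
    simp only [ContinuousMap.comp_apply, classifyingMap_cell]; rfl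

theorem classifyingMap_id : classifyingMap (𝟭 C) = ContinuousMap.id _ :=
  continuousMap_ext_cell fun n σ t => by rw [classifyingMap_cell]; rfl

end Cells

/-! ### Points of a simplex by their partial sums -/

section Cumulative

/-- The sum of the first `k` barycentric coordinates. -/
noncomputable def cumulative {n : ℕ} (t : stdSimplex ℝ (Fin (n + 1))) (k : ℕ) : ℝ :=
  ∑ i : Fin (n + 1) with i.val < k, t i

variable {m n : ℕ}

@[simp] theorem cumulative_zero (t : stdSimplex ℝ (Fin (n + 1))) : cumulative t 0 = 0 := by
  simp [cumulative]

theorem cumulative_of_lt (t : stdSimplex ℝ (Fin (n + 1))) {k : ℕ} (hk : n < k) :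
    cumulative t k = 1 := by
  rw [cumulative, Finset.filter_true_of_mem fun i _ => by omega]
  exact t.2.2

theorem cumulative_mono (t : stdSimplex ℝ (Fin (n + 1))) : Monotone (cumulative t) :=
  fun _ _ h => Finset.sum_le_sum_of_subset_of_nonneg
    (Finset.monotone_filter_right _ fun _ _ hi => hi.trans_le h) fun i _ _ => t.2.1 i

theorem cumulative_nonneg (t : stdSimplex ℝ (Fin (n + 1))) (k : ℕ) : 0 ≤ cumulative t k :=
  Finset.sum_nonneg fun i _ => t.2.1 i

theorem cumulative_le_one (t : stdSimplex ℝ (Fin (n + 1))) (k : ℕ) : cumulative t k ≤ 1 :=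
  (Finset.sum_le_sum_of_subset_of_nonneg (Finset.filter_subset _ _) fun i _ _ => t.2.1 i).trans
    t.2.2.le

theorem cumulative_succ (t : stdSimplex ℝ (Fin (n + 1))) (i : Fin (n + 1)) :
    cumulative t (i + 1) = cumulative t i + t i := by
  have : ({j : Fin (n + 1) | j.val < i + 1} : Finset _) =
      insert i ({j : Fin (n + 1) | j.val < i} : Finset _) := by
    ext j
    simp only [Finset.mem_filter, Finset.mem_univ, true_and, Finset.mem_insert, Fin.ext_iff]
    omega
  rw [cumulative, this, Finset.sum_insert (by simp), add_comm]
  rfl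

@[fun_prop] theorem continuous_cumulative (k : ℕ) :
    Continuous fun t : stdSimplex ℝ (Fin (n + 1)) => cumulative t k :=
  continuous_finsetSum _ fun i _ => (continuous_apply i).comp continuous_subtype_val

theorem cumulative_ext {x y : stdSimplex ℝ (Fin (n + 1))}
    (h : ∀ k ≤ n + 1, cumulative x k = cumulative y k) : x = y := by
  refine stdSimplex.ext (funext fun i => ?_)
  have h1 := h (i + 1) (by omega)
  rw [cumulative_succ, cumulative_succ, h i (by omega)] at h1
  exact add_left_cancel h1

/-- Pushing forward sums the weights over fibers, so a partial sum of the image is the sum of `t`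
over the preimage of an initial segment. -/
theorem cumulative_map (f : Fin (m + 1) → Fin (n + 1)) (t : stdSimplex ℝ (Fin (m + 1)))
    {k k' : ℕ} (h : ∀ i, (f i).val < k ↔ i.val < k') :
    cumulative (stdSimplex.map f t) k = cumulative t k' := by
  have h1 : ∀ j, stdSimplex.map f t j = ∑ i with f i = j, t i := fun j => by
    rw [stdSimplex.map_coe, FunOnFinite.linearMap_apply_apply]
  simp only [cumulative, h1]
  rw [← Finset.sum_fiberwise_of_maps_to (s := {i : Fin (m + 1) | i.val < k'}) (g := f)
    (t := {j : Fin (n + 1) | j.val < k}) fun i hi => by simpa [h] using hi]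
  refine Finset.sum_congr rfl fun j hj => Finset.sum_congr ?_ fun _ _ => rfl
  ext i
  simp only [Finset.mem_filter, Finset.mem_univ, true_and, ← h] at hj ⊢
  constructor
  · rintro rfl; exact ⟨hj, rfl⟩
  · exact fun h => h.2

/-- For monotone `f` this preimage is again an initial segment, so the hypothesis of
`cumulative_map` can always be met. -/
theorem exists_lt_iff (f : Fin (m + 1) →o Fin (n + 1)) (k : ℕ) :
    ∃ k' ≤ m + 1, ∀ i, (f i).val < k ↔ i.val < k' := by
  by_cases h : ∃ k' : ℕ, ∃ h : k' < m + 1, k ≤ (f ⟨k', h⟩).val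
  · classical
    refine ⟨Nat.find h, (Nat.find_spec h).1.le, fun i => ⟨fun hi => ?_, fun hi => ?_⟩⟩
    · by_contra! hc
      obtain ⟨h1, h2⟩ := Nat.find_spec h
      have h3 : f ⟨Nat.find h, h1⟩ ≤ f i := f.monotone hc
      rw [Fin.le_def] at h3
      omega
    · have := Nat.find_min h hi
      push Not at this
      exact this i.2
  · push Not at h
    exact ⟨m + 1, le_rfl, fun i => ⟨fun _ => i.2, fun hi => h i hi⟩⟩

/-- The point with prescribed sums of initial coordinates. -/
def ofCumulative (n : ℕ) (V : ℕ → ℝ) (hV : Monotone V) (h0 : V 0 = 0) (h1 : V (n + 1) = 1) :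
    stdSimplex ℝ (Fin (n + 1)) :=
  ⟨fun i => V (i + 1) - V i, fun i => sub_nonneg.2 (hV (Nat.le_succ _)), by
    rw [Fin.sum_univ_eq_sum_range (fun i => V (i + 1) - V i), Finset.sum_range_sub, h0, h1,
      sub_zero]⟩

theorem cumulative_ofCumulative {V : ℕ → ℝ} (hV : Monotone V) (h0 : V 0 = 0) (h1 : V (n + 1) = 1)
    {k : ℕ} (hk : k ≤ n + 1) : cumulative (ofCumulative n V hV h0 h1) k = V k := by
  induction k with
  | zero => rw [cumulative_zero, h0]
  | succ k ih =>
    have := cumulative_succ (ofCumulative n V hV h0 h1) ⟨k, hk⟩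
    rw [this, ih (by omega)]
    change V k + (V (k + 1) - V k) = V (k + 1)
    ring

end Cumulative

/-! ### Triangulation of the prism -/

section Prism

open unitInterval

variable {m n : ℕ}

/-- Cumulative sums of the weights of the prism simplices. -/
noncomputable def prismSum (j : ℕ) (t : stdSimplex ℝ (Fin (n + 1))) (c : ℝ) (k : ℕ) : ℝ :=
  -- Where `InPrism j t c` holds, this is the list of partial sums of `t` with `c` inserted at place
  -- `j + 1`. The clamping by `min` and `max` keeps the list monotone for all other `(t, c)`.
  if k ≤ j then min (cumulative t k) c else max (cumulative t (k - 1)) c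

theorem prismSum_mono (j : ℕ) (t : stdSimplex ℝ (Fin (n + 1))) (c : ℝ) :
    Monotone (prismSum j t c) := by
  intro k l h
  unfold prismSum
  split_ifs with h1 h2 h2
  · exact min_le_min_right _ (cumulative_mono t h)
  · exact (min_le_right _ _).trans (le_max_right _ _)
  · omega
  · exact max_le_max_right _ (cumulative_mono t (by omega))

/-- The weights of the `j`-th simplex of the prism `Δⁿ × [0, 1]`. -/
noncomputable def prismWeight (j : Fin (n + 1)) (t : stdSimplex ℝ (Fin (n + 1))) (c : I) :
    stdSimplex ℝ (Fin (n + 2)) :=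
  ofCumulative (n + 1) (prismSum j t c) (prismSum_mono _ _ _)
    (by simp [prismSum, c.2.1])
    (by rw [prismSum, if_neg (by omega), cumulative_of_lt _ (by omega), max_eq_left c.2.2])

theorem cumulative_prismWeight (j : Fin (n + 1)) (t : stdSimplex ℝ (Fin (n + 1))) (c : I)
    {k : ℕ} (hk : k ≤ n + 2) : cumulative (prismWeight j t c) k = prismSum j t c k :=
  cumulative_ofCumulative _ _ _ hk

theorem continuous_prismWeight (j : Fin (n + 1)) :
    Continuous fun p : stdSimplex ℝ (Fin (n + 1)) × I => prismWeight j p.1 p.2 := by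
  have h : ∀ k, Continuous fun p : stdSimplex ℝ (Fin (n + 1)) × I => prismSum j p.1 p.2 k := by
    intro k
    unfold prismSum
    split_ifs <;> fun_prop
  exact Continuous.subtype_mk (continuous_pi fun i => (h _).sub (h _)) _

/-- The condition for the `j`-th simplex of the prism to contain the point `(t, c)`. -/
def InPrism (j : Fin (n + 1)) (t : stdSimplex ℝ (Fin (n + 1))) (c : I) : Prop :=
  cumulative t j ≤ c ∧ c ≤ cumulative t (j + 1)

theorem exists_inPrism (t : stdSimplex ℝ (Fin (n + 1))) (c : I) : ∃ j, InPrism j t c := by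
  by_contra! h
  have : ∀ k ≤ n + 1, cumulative t k ≤ c := by
    intro k hk
    induction k with
    | zero => rw [cumulative_zero]; exact c.2.1
    | succ k ih =>
      by_contra! hc
      exact h ⟨k, hk⟩ ⟨ih (by omega), hc.le⟩
  refine h (Fin.last n) ⟨this _ (by simp), ?_⟩
  rw [cumulative_of_lt _ (by simp)]
  exact c.2.2

theorem isClosed_inPrism (j : Fin (n + 1)) :
    IsClosed {p : stdSimplex ℝ (Fin (n + 1)) × I | InPrism j p.1 p.2} :=
  have h : ∀ k, Continuous fun p : stdSimplex ℝ (Fin (n + 1)) × I => cumulative p.1 k :=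
    fun k => (continuous_cumulative k).comp continuous_fst
  have h' : Continuous fun p : stdSimplex ℝ (Fin (n + 1)) × I => (p.2 : ℝ) := by fun_prop
  (isClosed_le (h _) h').inter (isClosed_le h' (h _))

/-- First coordinate of the `j`-th chain of the prism. -/
def prismFst (j : Fin (n + 1)) : Fin (n + 2) →o Fin 2 where
  toFun i := if i.val ≤ j.val then 0 else 1
  monotone' i k h := by
    rw [Fin.le_def] at h
    dsimp only
    split_ifs
    · rfl
    · exact Fin.zero_le _
    · omega
    · rfl

/-- Second coordinate of the `j`-th chain of the prism. -/
def prismSnd (j : Fin (n + 1)) : Fin (n + 2) →o Fin (n + 1) where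
  toFun i := ⟨if i.val ≤ j.val then i.val else i.val - 1, by split_ifs <;> omega⟩
  monotone' i k h := by
    rw [Fin.le_def] at h ⊢
    dsimp only
    split_ifs <;> omega

/-- The map of prism simplices induced by a monotone map. -/
def prismMap (f : Fin (m + 1) →o Fin (n + 1)) (j : Fin (m + 1)) : Fin (m + 2) →o Fin (n + 2) where
  toFun i := if i.val ≤ j.val then (f (prismSnd j i)).castSucc else (f (prismSnd j i)).succ
  monotone' i k h := by
    have h1 := f.monotone ((prismSnd j).monotone h)
    rw [Fin.le_def] at h h1
    dsimp only
    rw [Fin.le_def]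
    split_ifs <;> simp only [Fin.val_castSucc, Fin.val_succ] <;> omega

theorem prismFst_apply (j : Fin (n + 1)) (i : Fin (n + 2)) :
    prismFst j i = if i.val ≤ j.val then 0 else 1 := rfl

theorem val_prismSnd (j : Fin (n + 1)) (i : Fin (n + 2)) :
    (prismSnd j i).val = if i.val ≤ j.val then i.val else i.val - 1 := rfl

theorem val_prismMap (f : Fin (m + 1) →o Fin (n + 1)) (j : Fin (m + 1)) (i : Fin (m + 2)) :
    (prismMap f j i).val =
      if i.val ≤ j.val then (f (prismSnd j i)).val else (f (prismSnd j i)).val + 1 := by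
  change (if i.val ≤ j.val then (f (prismSnd j i)).castSucc else (f (prismSnd j i)).succ).val = _
  split_ifs <;> rfl

theorem prismSnd_le {j : Fin (n + 1)} {i : Fin (n + 2)} (h : i.val ≤ j.val) :
    prismSnd j i ≤ j := by
  rw [Fin.le_def, val_prismSnd, if_pos h]
  exact h

theorem le_prismSnd {j : Fin (n + 1)} {i : Fin (n + 2)} (h : ¬ i.val ≤ j.val) :
    j ≤ prismSnd j i := by
  rw [Fin.le_def, val_prismSnd, if_neg h]
  omega

theorem prismFst_comp_prismMap (f : Fin (m + 1) →o Fin (n + 1)) (j : Fin (m + 1)) :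
    (prismFst (f j)).comp (prismMap f j) = prismFst j := by
  refine OrderHom.ext _ _ (funext fun i => ?_)
  rw [OrderHom.comp_coe, Function.comp_apply, prismFst_apply, prismFst_apply, val_prismMap]
  by_cases hi : i.val ≤ j.val
  · have h1 := Fin.le_def.1 (f.monotone (prismSnd_le hi))
    simp [hi, h1]
  · have h1 := Fin.le_def.1 (f.monotone (le_prismSnd hi))
    rw [if_neg hi, if_neg hi, if_neg (by omega)]

theorem prismSnd_comp_prismMap (f : Fin (m + 1) →o Fin (n + 1)) (j : Fin (m + 1)) :
    (prismSnd (f j)).comp (prismMap f j) = f.comp (prismSnd j) := by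
  refine OrderHom.ext _ _ (funext fun i => Fin.ext ?_)
  rw [OrderHom.comp_coe, Function.comp_apply, val_prismSnd, val_prismMap, OrderHom.comp_coe,
    Function.comp_apply]
  by_cases hi : i.val ≤ j.val
  · have h1 := Fin.le_def.1 (f.monotone (prismSnd_le hi))
    rw [if_pos hi, if_pos h1]
  · have h1 := Fin.le_def.1 (f.monotone (le_prismSnd hi))
    rw [if_neg hi, if_neg (by omega), Nat.add_sub_cancel]

theorem InPrism.map (f : Fin (m + 1) →o Fin (n + 1)) {j : Fin (m + 1)}
    {t : stdSimplex ℝ (Fin (m + 1))} {c : I} (h : InPrism j t c) :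
    InPrism (f j) (stdSimplex.map f t) c := by
  constructor
  · obtain ⟨k, -, hk⟩ := exists_lt_iff f (f j)
    rw [cumulative_map f t hk]
    refine le_trans (cumulative_mono t ?_) h.1
    have := hk j
    omega
  · obtain ⟨k, -, hk⟩ := exists_lt_iff f (f j + 1)
    rw [cumulative_map f t hk]
    refine h.2.trans (cumulative_mono t ?_)
    have := hk j
    omega

/-- Inserting `c` commutes with pushing forward, because the partial sums of the image occur among
those of `t`. With the two composition identities for `prismMap` this makes the prism homotopy
natural in the simplex. -/
theorem prismWeight_map (f : Fin (m + 1) →o Fin (n + 1)) {j : Fin (m + 1)}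
    {t : stdSimplex ℝ (Fin (m + 1))} {c : I} (h : InPrism j t c) :
    prismWeight (f j) (stdSimplex.map f t) c = stdSimplex.map (prismMap f j) (prismWeight j t c) := by
  refine cumulative_ext fun k hk => ?_
  have hle : ∀ i : Fin (m + 2), i.val ≤ j.val → (f (prismSnd j i)).val ≤ (f j).val ∧
      (prismSnd j i).val = i.val := fun i hi =>
    ⟨f.monotone (prismSnd_le hi), by rw [val_prismSnd, if_pos hi]⟩
  have hge : ∀ i : Fin (m + 2), ¬ i.val ≤ j.val → (f j).val ≤ (f (prismSnd j i)).val ∧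
      (prismSnd j i).val = i.val - 1 := fun i hi =>
    ⟨f.monotone (le_prismSnd hi), by rw [val_prismSnd, if_neg hi]⟩
  rw [cumulative_prismWeight _ _ _ hk]
  by_cases hkj : k ≤ (f j).val
  · obtain ⟨k', hk'm, hk'⟩ := exists_lt_iff f k
    have hk'j : k' ≤ j.val := by have := hk' j; omega
    rw [cumulative_map _ _ (k' := k'), cumulative_prismWeight _ _ _ (by omega), prismSum, prismSum,
      if_pos hkj, if_pos hk'j, cumulative_map f t hk']
    intro i
    rw [val_prismMap]
    split_ifs with hi
    · rw [hk', (hle i hi).2]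
    · have := hge i hi
      omega
  · obtain ⟨k', hk'm, hk'⟩ := exists_lt_iff f (k - 1)
    rw [prismSum, if_neg hkj, cumulative_map f t hk']
    -- At `k = f j + 1`, the place of the inserted breakpoint, both sides equal `c`; beyond it the
    -- indices are shifted by one.
    by_cases hkj' : k - 1 = (f j).val
    · have hk'j : k' ≤ j.val := by have := hk' j; omega
      rw [cumulative_map _ _ (k' := j + 1), cumulative_prismWeight _ _ _ (by omega), prismSum,
        if_neg (by omega), max_eq_right ((cumulative_mono t hk'j).trans h.1), Nat.add_sub_cancel,
        max_eq_right h.1]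
      intro i
      rw [val_prismMap]
      split_ifs with hi
      · have := hle i hi
        omega
      · have := hge i hi
        omega
    · have hk'j : j.val < k' := by have := hk' j; omega
      rw [cumulative_map _ _ (k' := k' + 1), cumulative_prismWeight _ _ _ (by omega), prismSum,
        if_neg (by omega), Nat.add_sub_cancel]
      intro i
      rw [val_prismMap]
      split_ifs with hi
      · have := hle i hi
        omega
      · have := hge i hi
        have := hk' (prismSnd j i)
        omega

/-- The inclusion of the common face of the `j`-th and the `j + 1`-st prism simplices. -/
def prismFace (j : ℕ) : Fin (n + 1) →o Fin (n + 2) where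
  toFun i := if i.val < j then i.castSucc else i.succ
  monotone' i k h := by
    rw [Fin.le_def] at h
    dsimp only
    rw [Fin.le_def]
    split_ifs <;> simp only [Fin.val_castSucc, Fin.val_succ] <;> omega

theorem val_prismFace (j : ℕ) (i : Fin (n + 1)) :
    (prismFace j i).val = if i.val < j then i.val else i.val + 1 := by
  change (if i.val < j then i.castSucc else i.succ).val = _
  split_ifs <;> rfl

/-- If `c` is already a partial sum, inserting it repeats a value, so vertex `l` gets weight zero.
This is used for gluing adjacent pieces and at both ends of the prism. -/
theorem prismWeight_eq_face {j : Fin (n + 1)} {l : ℕ} (hl : l = j.val ∨ l = j.val + 1)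
    {t : stdSimplex ℝ (Fin (n + 1))} {c : I} (h : cumulative t l = c) :
    prismWeight j t c = stdSimplex.map (prismFace l) t := by
  refine cumulative_ext fun k hk => ?_
  rw [cumulative_prismWeight _ _ _ hk, prismSum]
  by_cases hkl : k ≤ l
  · rw [cumulative_map _ _ (k' := k)]
    · split_ifs with hkj
      · rw [min_eq_left]
        rw [← h]
        exact cumulative_mono t hkl
      · obtain rfl : k = l := by omega
        rw [h, max_eq_right]
        rw [← h]
        exact cumulative_mono t (by omega)
    · intro i
      rw [val_prismFace]
      split_ifs <;> omega
  · rw [cumulative_map _ _ (k' := k - 1)]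
    · rw [if_neg (by omega), max_eq_left]
      rw [← h]
      exact cumulative_mono t (by omega)
    · intro i
      rw [val_prismFace]
      split_ifs <;> omega

end Prism

/-! ### Homotopies from natural transformations -/

section NaturalTransformations

universe u

variable {C D : Type u} [SmallCategory C] [SmallCategory D]

/-- The simplex of `D` given by a functor `Fin 2 × C ⥤ D`, a simplex of `C`, and a simplex of
`Fin 2 × Fin (n + 1)`. -/
def prismSimplex (H : Fin 2 × C ⥤ D) {m n : ℕ} (a : Fin (m + 1) →o Fin 2)
    (b : Fin (m + 1) →o Fin (n + 1)) (σ : Fin (n + 1) ⥤ C) : Fin (m + 1) ⥤ D :=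
  a.monotone.functor.prod' (b.monotone.functor ⋙ σ) ⋙ H

theorem prismSimplex_precomp (H : Fin 2 × C ⥤ D) {l m n : ℕ} (a : Fin (m + 1) →o Fin 2)
    (b : Fin (m + 1) →o Fin (n + 1)) (σ : Fin (n + 1) ⥤ C) (f : Fin (l + 1) →o Fin (m + 1)) :
    f.monotone.functor ⋙ prismSimplex H a b σ = prismSimplex H (a.comp f) (b.comp f) σ := rfl

theorem prismSimplex_simplex (H : Fin 2 × C ⥤ D) {l m n : ℕ} (a : Fin (m + 1) →o Fin 2)
    (b : Fin (m + 1) →o Fin (n + 1)) (f : Fin (n + 1) →o Fin (l + 1)) (σ : Fin (l + 1) ⥤ C) :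
    prismSimplex H a b (f.monotone.functor ⋙ σ) = prismSimplex H a (f.comp b) σ := rfl

/-- The map from the `j`-th simplex of the prism. -/
noncomputable def prismPiece (H : Fin 2 × C ⥤ D) {n : ℕ} (σ : Fin (n + 1) ⥤ C) (j : Fin (n + 1))
    (p : stdSimplex ℝ (Fin (n + 1)) × unitInterval) : classifyingSpace D :=
  cell (prismSimplex H (prismFst j) (prismSnd j) σ) (prismWeight j p.1 p.2)

theorem continuous_prismPiece (H : Fin 2 × C ⥤ D) {n : ℕ} (σ : Fin (n + 1) ⥤ C)
    (j : Fin (n + 1)) : Continuous (prismPiece H σ j) :=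
  (cell _).continuous.comp (continuous_prismWeight j)

theorem prismFace_comp (n : ℕ) (j k : Fin (n + 1)) (h : k.val = j.val + 1) :
    (prismFst j).comp (prismFace k) = (prismFst k).comp (prismFace k) ∧
    (prismSnd j).comp (prismFace k) = (prismSnd k).comp (prismFace k) := by
  constructor
  · refine OrderHom.ext _ _ (funext fun i => ?_)
    simp only [OrderHom.comp_coe, Function.comp_apply, prismFst_apply, val_prismFace]
    split_ifs <;> first | rfl | omega
  · refine OrderHom.ext _ _ (funext fun i => Fin.ext ?_)
    simp only [OrderHom.comp_coe, Function.comp_apply, val_prismSnd, val_prismFace]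
    split_ifs <;> omega

theorem prismPiece_adjacent (H : Fin 2 × C ⥤ D) {n : ℕ} (σ : Fin (n + 1) ⥤ C)
    {j k : Fin (n + 1)} (hjk : k.val = j.val + 1) {t : stdSimplex ℝ (Fin (n + 1))} {c : unitInterval}
    (h : cumulative t k = c) : prismPiece H σ j (t, c) = prismPiece H σ k (t, c) := by
  unfold prismPiece
  rw [prismWeight_eq_face (Or.inr hjk) h, prismWeight_eq_face (Or.inl rfl) h, cell_map, cell_map,
    prismSimplex_precomp, prismSimplex_precomp, (prismFace_comp n j k hjk).1,
    (prismFace_comp n j k hjk).2]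

/-- If pieces `j < k` both contain `(t, c)`, all partial sums from `j + 1` to `k` equal `c`; the
pieces in between contain the point too, and consecutive ones agree on their common face. -/
theorem prismPiece_eq_of_le (H : Fin 2 × C ⥤ D) {n : ℕ} (σ : Fin (n + 1) ⥤ C)
    {t : stdSimplex ℝ (Fin (n + 1))} {c : unitInterval} {j k : Fin (n + 1)} (hj : InPrism j t c)
    (hk : InPrism k t c) (hjk : j ≤ k) : prismPiece H σ j (t, c) = prismPiece H σ k (t, c) := by
  obtain ⟨k, hkn⟩ := k
  induction k with
  | zero =>
    obtain rfl : j = ⟨0, hkn⟩ := Fin.le_zero_iff.1 hjk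
    rfl
  | succ k ih =>
    rcases eq_or_lt_of_le hjk with rfl | hlt
    · rfl
    have hlt' : j.val < k + 1 := hlt
    have heq : cumulative t (k + 1) = c :=
      le_antisymm hk.1 (hj.2.trans (cumulative_mono t (by omega)))
    rw [ih (by omega) ⟨?_, heq.ge⟩ (Fin.le_def.2 (by simp only; omega))]
    · exact prismPiece_adjacent H σ rfl heq
    · exact (cumulative_mono t (Nat.le_succ k)).trans heq.le

theorem prismPiece_eq (H : Fin 2 × C ⥤ D) {n : ℕ} (σ : Fin (n + 1) ⥤ C)
    {t : stdSimplex ℝ (Fin (n + 1))} {c : unitInterval} {j k : Fin (n + 1)} (hj : InPrism j t c)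
    (hk : InPrism k t c) : prismPiece H σ j (t, c) = prismPiece H σ k (t, c) := by
  rcases le_total j k with h | h
  · exact prismPiece_eq_of_le H σ hj hk h
  · exact (prismPiece_eq_of_le H σ hk hj h).symm

/-- The map from the prism `Δⁿ × [0, 1]`. -/
noncomputable def prism (H : Fin 2 × C ⥤ D) {n : ℕ} (σ : Fin (n + 1) ⥤ C)
    (p : stdSimplex ℝ (Fin (n + 1)) × unitInterval) : classifyingSpace D :=
  prismPiece H σ (exists_inPrism p.1 p.2).choose p

theorem prism_eq (H : Fin 2 × C ⥤ D) {n : ℕ} (σ : Fin (n + 1) ⥤ C)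
    {t : stdSimplex ℝ (Fin (n + 1))} {c : unitInterval} {j : Fin (n + 1)} (hj : InPrism j t c) :
    prism H σ (t, c) = prismPiece H σ j (t, c) :=
  prismPiece_eq H σ (exists_inPrism t c).choose_spec hj

theorem continuous_prism (H : Fin 2 × C ⥤ D) {n : ℕ} (σ : Fin (n + 1) ⥤ C) :
    Continuous (prism H σ) :=
  (locallyFinite_of_finite fun j : Fin (n + 1) =>
    {p : stdSimplex ℝ (Fin (n + 1)) × unitInterval | InPrism j p.1 p.2}).continuous
    (Set.eq_univ_of_forall fun p => Set.mem_iUnion.2 (exists_inPrism p.1 p.2))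
    isClosed_inPrism
    fun j => (continuous_prismPiece H σ j).continuousOn.congr fun _ hp => prism_eq H σ hp

theorem prism_map (H : Fin 2 × C ⥤ D) {m n : ℕ} (f : Fin (m + 1) →o Fin (n + 1))
    (σ : Fin (n + 1) ⥤ C) (t : stdSimplex ℝ (Fin (m + 1))) (c : unitInterval) :
    prism H σ (stdSimplex.map f t, c) = prism H (f.monotone.functor ⋙ σ) (t, c) := by
  obtain ⟨j, hj⟩ := exists_inPrism t c
  rw [prism_eq H _ hj, prism_eq H σ (hj.map f)]
  unfold prismPiece
  rw [prismWeight_map f hj, cell_map, prismSimplex_precomp, prismSimplex_simplex,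
    prismFst_comp_prismMap, prismSnd_comp_prismMap]

theorem prism_one (H : Fin 2 × C ⥤ D) {n : ℕ} (σ : Fin (n + 1) ⥤ C)
    (t : stdSimplex ℝ (Fin (n + 1))) :
    prism H σ (t, 1) = cell (σ ⋙ Functor.prod' ((Functor.const C).obj 0) (𝟭 C) ⋙ H) t := by
  have h1 : cumulative t (n + 1) = (1 : unitInterval) := cumulative_of_lt t (Nat.lt_succ_self n)
  have hj : InPrism (Fin.last n) t 1 := ⟨cumulative_le_one _ _, h1.ge⟩
  rw [prism_eq H σ hj]
  unfold prismPiece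
  rw [prismWeight_eq_face (l := n + 1) (Or.inr rfl) h1, cell_map, prismSimplex_precomp]
  have ha : (prismFst (Fin.last n)).comp (prismFace (n + 1)) = OrderHom.const _ 0 := by
    refine OrderHom.ext _ _ (funext fun i => ?_)
    simp only [OrderHom.comp_coe, Function.comp_apply, prismFst_apply, val_prismFace, Fin.val_last]
    split_ifs <;> first | rfl | omega
  have hb : (prismSnd (Fin.last n)).comp (prismFace (n + 1)) = OrderHom.id := by
    refine OrderHom.ext _ _ (funext fun i => Fin.ext ?_)
    simp only [OrderHom.comp_coe, Function.comp_apply, val_prismSnd, val_prismFace, Fin.val_last,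
      OrderHom.id_coe, id]
    split_ifs <;> omega
  rw [ha, hb]
  rfl

theorem prism_zero (H : Fin 2 × C ⥤ D) {n : ℕ} (σ : Fin (n + 1) ⥤ C)
    (t : stdSimplex ℝ (Fin (n + 1))) :
    prism H σ (t, 0) = cell (σ ⋙ Functor.prod' ((Functor.const C).obj 1) (𝟭 C) ⋙ H) t := by
  have h0 : cumulative t 0 = (0 : unitInterval) := cumulative_zero t
  have hj : InPrism 0 t 0 := ⟨h0.le, cumulative_nonneg _ _⟩
  rw [prism_eq H σ hj]
  unfold prismPiece
  rw [prismWeight_eq_face (l := 0) (Or.inl rfl) h0, cell_map, prismSimplex_precomp]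
  have ha : (prismFst (0 : Fin (n + 1))).comp (prismFace 0) = OrderHom.const _ 1 := by
    refine OrderHom.ext _ _ (funext fun i => ?_)
    simp [prismFst_apply, val_prismFace]
  have hb : (prismSnd (0 : Fin (n + 1))).comp (prismFace 0) = OrderHom.id := by
    refine OrderHom.ext _ _ (funext fun i => Fin.ext ?_)
    simp [val_prismSnd, val_prismFace]
  rw [ha, hb]
  rfl

/-- The family of homotopies on cells defined by a functor `Fin 2 × C ⥤ D`. -/
noncomputable def prismFamily (H : Fin 2 × C ⥤ D) :
    CellFamily C C(unitInterval, classifyingSpace D) where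
  -- Taking values in the path space reduces a map out of a product with the interval to a map out
  -- of the classifying space. The time is reversed because the prism is at `0 : Fin 2` when `c =
  -- 1`.
  toFun {n} σ := ContinuousMap.curry
    ⟨fun p : stdSimplex ℝ (Fin (n + 1)) × unitInterval => prism H σ (p.1, unitInterval.symm p.2),
      (continuous_prism H σ).comp (by fun_prop)⟩
  map f σ t := ContinuousMap.ext fun c => prism_map H f σ t _

/-- A functor `Fin 2 × C ⥤ D` defines a homotopy of maps of classifying spaces. -/
noncomputable def prismHomotopy (H : Fin 2 × C ⥤ D) :
    (classifyingMap (Functor.prod' ((Functor.const C).obj 0) (𝟭 C) ⋙ H)).Homotopy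
      (classifyingMap (Functor.prod' ((Functor.const C).obj 1) (𝟭 C) ⋙ H)) where
  toContinuousMap := (ContinuousMap.uncurry (prismFamily H).desc).comp ContinuousMap.prodSwap
  map_zero_left x := by
    obtain ⟨n, σ, t, rfl⟩ := exists_cell x
    rw [classifyingMap_cell, ← prism_one, ← unitInterval.symm_zero]
    exact DFunLike.congr_fun ((prismFamily H).desc_cell σ t) 0
  map_one_left x := by
    obtain ⟨n, σ, t, rfl⟩ := exists_cell x
    rw [classifyingMap_cell, ← prism_zero, ← unitInterval.symm_one]
    exact DFunLike.congr_fun ((prismFamily H).desc_cell σ t) 1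

theorem prismHomotopy_cell (H : Fin 2 × C ⥤ D) {n : ℕ} (σ : Fin (n + 1) ⥤ C)
    (t : stdSimplex ℝ (Fin (n + 1))) (s : unitInterval) :
    prismHomotopy H (s, cell σ t) = prism H σ (t, unitInterval.symm s) :=
  DFunLike.congr_fun ((prismFamily H).desc_cell σ t) s

/-- The functor `Fin 2 × C ⥤ D` given by a natural transformation. -/
def prismFunctor {F G : C ⥤ D} (α : F ⟶ G) : Fin 2 × C ⥤ D :=
  Functor.uncurry.obj (ComposableArrows.mk₁ α)

theorem prod'_zero_prismFunctor {F G : C ⥤ D} (α : F ⟶ G) :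
    Functor.prod' ((Functor.const C).obj 0) (𝟭 C) ⋙ prismFunctor α = F := by
  refine CategoryTheory.Functor.ext (fun X => rfl) fun X Y f => ?_
  exact (Category.id_comp (F.map f)).trans
    ((Category.id_comp _).trans (Category.comp_id (F.map f))).symm

theorem prod'_one_prismFunctor {F G : C ⥤ D} (α : F ⟶ G) :
    Functor.prod' ((Functor.const C).obj 1) (𝟭 C) ⋙ prismFunctor α = G := by
  refine CategoryTheory.Functor.ext (fun X => rfl) fun X Y f => ?_
  exact (Category.id_comp (G.map f)).trans
    ((Category.id_comp _).trans (Category.comp_id (G.map f))).symm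

/-- A natural transformation defines a homotopy of maps of classifying spaces. -/
noncomputable def natTransHomotopy {F G : C ⥤ D} (α : F ⟶ G) :
    (classifyingMap F).Homotopy (classifyingMap G) :=
  (prismHomotopy (prismFunctor α)).cast (congrArg classifyingMap (prod'_zero_prismFunctor α))
    (congrArg classifyingMap (prod'_one_prismFunctor α))

theorem homotopic_of_natTrans {F G : C ⥤ D} (α : F ⟶ G) :
    (classifyingMap F).Homotopic (classifyingMap G) :=
  ⟨natTransHomotopy α⟩

/-- The homotopy moves the vertex along the edge `α.app X`, which is degenerate here. This provides
the based contraction needed for the homotopy fiber. -/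
theorem natTransHomotopy_vertex {F G : C ⥤ D} (α : F ⟶ G) (X : C) (h : F.obj X = G.obj X)
    (hα : α.app X = eqToHom h) (s : unitInterval) :
    natTransHomotopy α (s, vertex X) = vertex (F.obj X) := by
  rw [vertex_eq_cell X default, vertex_eq_cell (F.obj X) (stdSimplex.map
    (OrderHom.const (Fin 2) (0 : Fin 1)) (prismWeight 0 default (unitInterval.symm s))), cell_map]
  refine (prismHomotopy_cell _ _ _ _).trans ?_
  have hj : InPrism 0 (default : stdSimplex ℝ (Fin 1)) (unitInterval.symm s) :=
    ⟨(cumulative_zero _).trans_le (unitInterval.symm s).2.1,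
      (unitInterval.symm s).2.2.trans (cumulative_of_lt _ (by simp)).ge⟩
  rw [prism_eq _ _ hj]
  unfold prismPiece
  have key : prismSimplex (prismFunctor α) (prismFst 0) (prismSnd 0) (ComposableArrows.mk₀ X) =
      (OrderHom.const (Fin 2) (0 : Fin 1)).monotone.functor ⋙ ComposableArrows.mk₀ (F.obj X) := by
    refine ComposableArrows.ext₁ rfl h.symm ?_
    change α.app X ≫ G.map (𝟙 X) = 𝟙 _ ≫ 𝟙 _ ≫ eqToHom h
    rw [hα, G.map_id, Category.comp_id, Category.id_comp, Category.id_comp]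
  rw [key]

end NaturalTransformations

/-! ### Continuous functions measuring step functions -/

section StepSums

universe u

/-- The integral of a function on the vertices against the step measure of a point. -/
noncomputable def stepSum {n : ℕ} (φ : Fin (n + 1) → ℝ) (h : ℝ → ℝ)
    (t : stdSimplex ℝ (Fin (n + 1))) : ℝ :=
  ∑ i, φ i * (h (cumulative t (i + 1)) - h (cumulative t i))

/-- The fibers of a monotone map are intervals, over which the increments of `h` telescope. Hence
step sums are compatible with faces and degeneracies and descend to the classifying space. -/
theorem stepSum_map {m n : ℕ} (f : Fin (m + 1) →o Fin (n + 1)) (φ : Fin (n + 1) → ℝ) (h : ℝ → ℝ)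
    (t : stdSimplex ℝ (Fin (m + 1))) :
    stepSum φ h (stdSimplex.map f t) = stepSum (φ ∘ f) h t := by
  choose κ hκm hκ using exists_lt_iff f
  unfold stepSum
  rw [← Finset.sum_fiberwise (s := Finset.univ) (g := f)]
  refine Finset.sum_congr rfl fun j _ => ?_
  have h1 : ∑ i with f i = j, (φ ∘ f) i * (h (cumulative t (i + 1)) - h (cumulative t i)) =
      φ j * ∑ i with f i = j, (h (cumulative t (i + 1)) - h (cumulative t i)) := by
    rw [Finset.mul_sum]
    refine Finset.sum_congr rfl fun i hi => ?_
    rw [Function.comp_apply, (Finset.mem_filter.1 hi).2]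
  rw [h1, cumulative_map f t (hκ _), cumulative_map f t (hκ _)]
  congr 1
  have hle : κ j ≤ κ (j + 1) := by
    by_contra! hc
    have h2 := hκ (j + 1) ⟨κ (j + 1), by have := hκm j; omega⟩
    have h3 := hκ j ⟨κ (j + 1), by have := hκm j; omega⟩
    simp only at h2 h3
    omega
  have h4 : ∀ i : Fin (m + 1), f i = j ↔ κ j ≤ i.val ∧ i.val < κ (j + 1) := fun i => by
    have h2 := hκ (j + 1) i
    have h3 := hκ j i
    rw [Fin.ext_iff]
    omega
  simp only [h4]
  rw [Finset.sum_filter, Fin.sum_univ_eq_sum_range (fun i => if κ j ≤ i ∧ i < κ (j + 1) then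
    h (cumulative t (i + 1)) - h (cumulative t i) else 0), ← Finset.sum_filter]
  have h5 : {i ∈ Finset.range (m + 1) | κ j ≤ i ∧ i < κ (j + 1)} =
      Finset.Ico (κ j) (κ (j + 1)) := by
    ext i
    have := hκm (j + 1)
    simp only [Finset.mem_filter, Finset.mem_range, Finset.mem_Ico]
    omega
  rw [h5, Finset.sum_Ico_eq_sub _ hle, Finset.sum_range_sub (fun i => h (cumulative t i)),
    Finset.sum_range_sub (fun i => h (cumulative t i))]
  ring

theorem continuous_stepSum {n : ℕ} (φ : Fin (n + 1) → ℝ) {h : ℝ → ℝ} (hh : Continuous h) :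
    Continuous (stepSum φ h) := by
  unfold stepSum
  fun_prop

theorem stepSum_one {n : ℕ} (h : ℝ → ℝ) (t : stdSimplex ℝ (Fin (n + 1))) :
    stepSum (fun _ => 1) h t = h 1 - h 0 := by
  unfold stepSum
  simp only [one_mul]
  rw [Fin.sum_univ_eq_sum_range (fun i => h (cumulative t (i + 1)) - h (cumulative t i)),
    Finset.sum_range_sub (fun i => h (cumulative t i)), cumulative_zero,
    cumulative_of_lt t (Nat.lt_succ_self n)]

variable {C : Type u} [SmallCategory C]

/-- The continuous function on the classifying space whose values on cells are step sums. -/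
noncomputable def stepFamily (φ : C → ℝ) (h : C(ℝ, ℝ)) : CellFamily C (ULift.{u} ℝ) where
  toFun σ := ⟨fun t => ⟨stepSum (fun i => φ (σ.obj i)) h t⟩,
    continuous_uliftUp.comp (continuous_stepSum _ h.continuous)⟩
  map f σ t := congrArg ULift.up (stepSum_map f (fun i => φ (σ.obj i)) h t)

/-- The measure of the part of `[0, c]` on which the step function of a point satisfies `p`. -/
noncomputable def occupation (p : C → Prop) (c : ℝ) (x : classifyingSpace C) : ℝ :=
  open Classical in
  ((stepFamily (fun X => if p X then 1 else 0) ⟨fun y => min y c, by fun_prop⟩).desc x).down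

theorem continuous_occupation (p : C → Prop) (c : ℝ) : Continuous (occupation p c) :=
  continuous_uliftDown.comp (ContinuousMap.continuous _)

open Classical in
theorem occupation_cell (p : C → Prop) (c : ℝ) {n : ℕ} (σ : Fin (n + 1) ⥤ C)
    (t : stdSimplex ℝ (Fin (n + 1))) :
    occupation p c (cell σ t) = stepSum (fun i => if p (σ.obj i) then 1 else 0)
      (fun y => min y c) t :=
  congrArg ULift.down (CellFamily.desc_cell _ σ t)

/-- Take for `X` the first vertex of positive weight and for `c` that weight: the step function
equals `X` on all of `[0, c]`. -/
theorem exists_half_lt_occupation (x : classifyingSpace C) :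
    ∃ (X : C) (c : ℝ), 0 < c ∧ ∀ p : C → Prop, p X → c / 2 < occupation p c x := by
  classical
  obtain ⟨n, σ, t, rfl⟩ := exists_cell x
  obtain ⟨i, hi, hi'⟩ : ∃ i : Fin (n + 1), cumulative t i = 0 ∧ 0 < cumulative t (i + 1) := by
    by_contra! hc
    have h : ∀ k ≤ n + 1, cumulative t k = 0 := fun k hk => by
      induction k with
      | zero => exact cumulative_zero t
      | succ k ih => exact le_antisymm (hc ⟨k, hk⟩ (ih (by omega))) (cumulative_nonneg _ _)
    have := h (n + 1) le_rfl
    rw [cumulative_of_lt _ (Nat.lt_succ_self n)] at this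
    exact one_ne_zero this
  refine ⟨σ.obj i, cumulative t (i + 1), hi', fun p hp => ?_⟩
  rw [occupation_cell]
  refine (half_lt_self hi').trans_le ?_
  have := Finset.single_le_sum (s := Finset.univ) (a := i)
    (f := fun i' : Fin (n + 1) => (if p (σ.obj i') then (1 : ℝ) else 0) *
      (min (cumulative t (i' + 1)) (cumulative t (i + 1)) -
        min (cumulative t i') (cumulative t (i + 1)))) (fun j _ =>
      mul_nonneg (by split_ifs <;> norm_num) (sub_nonneg.2 (min_le_min_right _
        (cumulative_mono t (Nat.le_succ j))))) (Finset.mem_univ i)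
  refine le_trans (le_of_eq ?_) this
  simp only [if_pos hp, hi, min_self, min_eq_left hi'.le]
  ring

/-- At each vertex at most one of `X` and `F.obj X` satisfies `p`, so the two times spent in `p` are
disjoint parts of `[0, c]`. -/
theorem occupation_add_le (F : C ⥤ C) {p : C → Prop} (hp : ∀ X, p X → ¬ p (F.obj X)) {c : ℝ}
    (hc : 0 ≤ c) (x : classifyingSpace C) :
    occupation p c x + occupation p c (classifyingMap F x) ≤ c := by
  classical
  obtain ⟨n, σ, t, rfl⟩ := exists_cell x
  rw [classifyingMap_cell, occupation_cell, occupation_cell]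
  have h1 := stepSum_one (fun y => min y c) t
  rw [min_eq_left hc, sub_zero] at h1
  refine le_trans ?_ (h1.le.trans (min_le_right _ _))
  unfold stepSum
  rw [← Finset.sum_add_distrib]
  refine Finset.sum_le_sum fun i _ => ?_
  rw [← add_mul]
  refine mul_le_mul_of_nonneg_right ?_ (sub_nonneg.2 (min_le_min_right _
        (cumulative_mono t (Nat.le_succ _))))
  have := hp (σ.obj i)
  simp only [Functor.comp_obj]
  split_ifs <;> first | (exfalso; tauto) | norm_num

end StepSums

/-! ### The fiber category as a covering -/

section Fiber

universe u

variable {C G : Type u} [SmallCategory C] [Groupoid.{u} G] {Z : G} {F : C ⥤ G}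

/-- The functor to the fiber category with prescribed projection and structure maps. -/
def fiberLift {J : Type*} [Category* J] (p : J ⥤ C) (f : ∀ j, Z ⟶ F.obj (p.obj j))
    (hf : ∀ {j k} (h : j ⟶ k), f j ≫ F.map (p.map h) = f k) : J ⥤ StructuredArrow Z F where
  obj j := StructuredArrow.mk (f j)
  map h := StructuredArrow.homMk (p.map h) (hf h)

theorem fiberLift_congr {J : Type*} [Category* J] (p : J ⥤ C) {f g : ∀ j, Z ⟶ F.obj (p.obj j)}
    (hf : ∀ {j k} (h : j ⟶ k), f j ≫ F.map (p.map h) = f k)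
    (hg : ∀ {j k} (h : j ⟶ k), g j ≫ F.map (p.map h) = g k) (h : ∀ j, f j = g j) :
    fiberLift p f hf = fiberLift p g hg := by
  obtain rfl : f = g := funext h
  rfl

theorem transport_comp {n : ℕ} (σ : Fin (n + 1) ⥤ C) (f : Z ⟶ F.obj (σ.obj 0))
    {j k : Fin (n + 1)} (h : j ⟶ k) :
    (f ≫ F.map (σ.map (homOfLE (Fin.zero_le j)))) ≫ F.map (σ.map h) =
      f ≫ F.map (σ.map (homOfLE (Fin.zero_le k))) := by
  rw [Category.assoc, ← F.map_comp, ← σ.map_comp]; rfl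

/-- The simplex of the fiber category over a simplex of `C` with prescribed first vertex. -/
def liftSimplex {n : ℕ} (σ : Fin (n + 1) ⥤ C) (f : Z ⟶ F.obj (σ.obj 0)) :
    Fin (n + 1) ⥤ StructuredArrow Z F :=
  fiberLift σ (fun j => f ≫ F.map (σ.map (homOfLE (Fin.zero_le j)))) (transport_comp σ f)

/-- The commuting triangles force every structure map from the one at vertex `0`. -/
theorem eq_liftSimplex {n : ℕ} (τ : Fin (n + 1) ⥤ StructuredArrow Z F) :
    τ = liftSimplex (τ ⋙ StructuredArrow.proj Z F) (τ.obj 0).hom :=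
  fiberLift_congr (τ ⋙ StructuredArrow.proj Z F) (f := fun j => (τ.obj j).hom)
    (fun h => StructuredArrow.w (τ.map h)) (transport_comp (τ ⋙ StructuredArrow.proj Z F) _)
    fun j => (StructuredArrow.w (τ.map (homOfLE (Fin.zero_le j)))).symm

theorem exists_liftSimplex {n : ℕ} (τ : Fin (n + 1) ⥤ StructuredArrow Z F) :
    ∃ (σ : Fin (n + 1) ⥤ C) (f : Z ⟶ F.obj (σ.obj 0)), τ = liftSimplex σ f :=
  ⟨_, _, eq_liftSimplex τ⟩

theorem liftSimplex_map {n : ℕ} (σ : Fin (n + 1) ⥤ C) (f : Z ⟶ F.obj (σ.obj 0)) (g : Z ⟶ Z) :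
    liftSimplex σ f ⋙ StructuredArrow.map g = liftSimplex σ (g ≫ f) :=
  fiberLift_congr σ (f := fun j => g ≫ f ≫ F.map (σ.map (homOfLE (Fin.zero_le j))))
    (fun h => StructuredArrow.w ((liftSimplex σ f ⋙ StructuredArrow.map g).map h)) (transport_comp σ _)
    fun j => (Category.assoc _ _ _).symm

theorem precomp_liftSimplex {m n : ℕ} (a : Fin (m + 1) →o Fin (n + 1)) (σ : Fin (n + 1) ⥤ C)
    (f : Z ⟶ F.obj (σ.obj 0)) :
    a.monotone.functor ⋙ liftSimplex σ f = liftSimplex (a.monotone.functor ⋙ σ)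
      (f ≫ F.map (σ.map (homOfLE (Fin.zero_le (a 0))))) :=
  eq_liftSimplex (a.monotone.functor ⋙ liftSimplex σ f)

noncomputable instance (F : C ⥤ G) :
    MulAction (Aut Z) (classifyingSpace (StructuredArrow Z F)) where
  -- Precomposition reverses the order of products in `Aut Z`; the inverse turns it into a left
  -- action.
  smul g := classifyingMap (StructuredArrow.map g.inv)
  one_smul x := by
    obtain ⟨n, τ, t, rfl⟩ := exists_cell x
    obtain ⟨σ, f, rfl⟩ := exists_liftSimplex τ
    refine (classifyingMap_cell _ _ _).trans ?_
    rw [liftSimplex_map]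
    exact congrArg (fun f => cell (liftSimplex _ f) t) (Category.id_comp _)
  mul_smul g h x := by
    obtain ⟨n, τ, t, rfl⟩ := exists_cell x
    obtain ⟨σ, f, rfl⟩ := exists_liftSimplex τ
    refine (classifyingMap_cell _ _ _).trans
      (Eq.trans ?_ ((congrArg (classifyingMap _) (classifyingMap_cell _ _ _)).trans
        (classifyingMap_cell _ _ _)).symm)
    rw [liftSimplex_map, liftSimplex_map, liftSimplex_map]
    exact congrArg (fun f => cell (liftSimplex _ f) t) (Category.assoc _ _ _)

theorem smul_def (g : Aut Z) (x : classifyingSpace (StructuredArrow Z F)) :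
    g • x = classifyingMap (StructuredArrow.map g.inv) x := rfl

theorem smul_cell_liftSimplex (g : Aut Z) {n : ℕ} (σ : Fin (n + 1) ⥤ C)
    (f : Z ⟶ F.obj (σ.obj 0)) (t : stdSimplex ℝ (Fin (n + 1))) :
    g • cell (liftSimplex σ f) t = cell (liftSimplex σ (g.inv ≫ f)) t := by
  rw [smul_def, classifyingMap_cell, liftSimplex_map]

theorem cell_liftSimplex_mem_orbit {n : ℕ} (σ : Fin (n + 1) ⥤ C) (f f' : Z ⟶ F.obj (σ.obj 0))
    (t : stdSimplex ℝ (Fin (n + 1))) :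
    cell (liftSimplex σ f) t ∈ MulAction.orbit (Aut Z) (cell (liftSimplex σ f') t) := by
  -- The inverse of this automorphism is `f` followed by the inverse of `f'`, and it carries `f'` to
  -- `f`.
  refine ⟨(Groupoid.isoEquivHom _ _).symm (f' ≫ Groupoid.inv f), ?_⟩
  refine (smul_cell_liftSimplex _ σ f' t).trans ?_
  congr 2
  simp [Groupoid.isoEquivHom]

/-- The projection from the classifying space of the fiber category. -/
noncomputable abbrev fiberProj (Z : G) (F : C ⥤ G) :
    C(classifyingSpace (StructuredArrow Z F), classifyingSpace C) :=
  classifyingMap (StructuredArrow.proj Z F)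

theorem fiberProj_smul (g : Aut Z) (x : classifyingSpace (StructuredArrow Z F)) :
    fiberProj Z F (g • x) = fiberProj Z F x := by
  rw [smul_def, ← ContinuousMap.comp_apply, ← classifyingMap_comp]
  rfl

instance : ContinuousConstSMul (Aut Z) (classifyingSpace (StructuredArrow Z F)) where
  continuous_const_smul g := (classifyingMap (StructuredArrow.map g.inv)).continuous

/-- The section of the projection with values in the orbit space. -/
noncomputable def orbitFamily (F : C ⥤ G) (hZ : ∀ X : G, Nonempty (Z ⟶ X)) :
    CellFamily C (MulAction.orbitRel.Quotient (Aut Z) (classifyingSpace (StructuredArrow Z F))) where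
  toFun σ := ⟨fun t => Quotient.mk _ (cell (liftSimplex σ (hZ _).some) t),
    continuous_quotient_mk'.comp (cell _).continuous⟩
  map f σ t := by
    refine Quotient.sound ?_
    rw [cell_map, precomp_liftSimplex]
    exact cell_liftSimplex_mem_orbit _ _ _ t

/-- Lifts of a simplex differ by an automorphism, so the arbitrary choice in `orbitFamily`
disappears in the orbit space. Consequently the fibers of the projection are exactly the orbits, and
the base is the orbit space also as a topological space. -/
theorem orbitFamily_desc_fiberProj (F : C ⥤ G) (hZ : ∀ X : G, Nonempty (Z ⟶ X))
    (x : classifyingSpace (StructuredArrow Z F)) :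
    (orbitFamily F hZ).desc (fiberProj Z F x) = Quotient.mk _ x := by
  obtain ⟨n, τ, t, rfl⟩ := exists_cell x
  rw [classifyingMap_cell, CellFamily.desc_cell]
  refine Quotient.sound ?_
  obtain ⟨σ, f, rfl⟩ := exists_liftSimplex τ
  exact cell_liftSimplex_mem_orbit _ _ _ t

theorem fiberProj_eq_iff (hZ : ∀ X : G, Nonempty (Z ⟶ X))
    {x y : classifyingSpace (StructuredArrow Z F)} :
    fiberProj Z F x = fiberProj Z F y ↔ x ∈ MulAction.orbit (Aut Z) y := by
  constructor
  · intro h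
    have h1 := congrArg (orbitFamily F hZ).desc h
    rw [orbitFamily_desc_fiberProj, orbitFamily_desc_fiberProj] at h1
    exact Quotient.exact h1
  · rintro ⟨g, rfl⟩
    exact fiberProj_smul g y

theorem fiberProj_surjective (hZ : ∀ X : G, Nonempty (Z ⟶ X)) :
    Function.Surjective (fiberProj Z F) := fun x => by
  obtain ⟨n, σ, t, rfl⟩ := exists_cell x
  exact ⟨cell (liftSimplex σ (hZ _).some) t, classifyingMap_cell _ _ _⟩

theorem isQuotientMap_fiberProj (hZ : ∀ X : G, Nonempty (Z ⟶ X)) :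
    Topology.IsQuotientMap (fiberProj Z F) := by
  have h : Continuous (Quotient.lift (s := MulAction.orbitRel (Aut Z) _) (fiberProj Z F)
      fun x y hxy => (fiberProj_eq_iff hZ).2 hxy) :=
    (fiberProj Z F).continuous.quotient_lift _
  refine Topology.IsQuotientMap.comp (g := Quotient.lift _ _)
    (Topology.IsQuotientMap.of_inverse (f := (orbitFamily F hZ).desc)
      (ContinuousMap.continuous _) h fun x => ?_) isQuotientMap_quotient_mk'
  obtain ⟨y, rfl⟩ := fiberProj_surjective (F := F) hZ x
  rw [orbitFamily_desc_fiberProj]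
  rfl

/-- The projection from the classifying space of the fiber category is a covering map. -/
theorem isQuotientCoveringMap_fiberProj (hZ : ∀ X : G, Nonempty (Z ⟶ X)) :
    IsQuotientCoveringMap (fiberProj Z F) (Aut Z) where
  toIsQuotientMap := isQuotientMap_fiberProj hZ
  apply_eq_iff_mem_orbit := fiberProj_eq_iff hZ
  disjoint x := by
    obtain ⟨X, c, hc, hX⟩ := exists_half_lt_occupation x
    -- The color compares the structure map with a reference arrow depending only on `Y.right`, so
    -- `g` changes it to `g.inv ≫ color Y`. The points spending more than half of `[0, c]` in one
    -- color form an open set, and `g ≠ 1` moves it off itself.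
    let color (Y : StructuredArrow Z F) : Z ⟶ Z := Y.hom ≫ Groupoid.inv (hZ (F.obj Y.right)).some
    let p (Y : StructuredArrow Z F) : Prop := color Y = color X
    refine ⟨{y | c / 2 < occupation p c y},
      (isOpen_lt continuous_const (continuous_occupation p c)).mem_nhds (hX p rfl), fun g => ?_⟩
    rintro ⟨_, ⟨y, hy, rfl⟩, hgy⟩
    by_contra hg
    have := occupation_add_le (StructuredArrow.map g.inv) (p := p) (fun Y hY hY' => hg ?_) hc.le y
    · simp only [Set.mem_ofPred_eq] at hy hgy
      rw [smul_def] at hgy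
      linarith
    · have h1 : g.inv ≫ color Y = 𝟙 Z ≫ color Y := by
        rw [Category.id_comp]
        refine Eq.trans ?_ (hY'.trans hY.symm)
        exact (Category.assoc _ _ _).symm
      rw [cancel_mono] at h1
      have h2 : g⁻¹ = 1 := Iso.ext h1
      rwa [inv_eq_one] at h2

end Fiber

/-! ### Pullbacks of contractible coverings and homotopy fibers -/

section CoveringFiber

open unitInterval

variable {X B E Y : Type*} [TopologicalSpace X] [TopologicalSpace B] [TopologicalSpace E]
  [TopologicalSpace Y]

/-- A commutative square of an open map over a covering map which is bijective onto the pullback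
is a pullback of topological spaces. -/
noncomputable def pullbackHomeomorph (p : C(X, B)) (πE : C(E, B)) (πY : C(Y, X)) (q : C(Y, E))
    (comm : ∀ y, p (πY y) = πE (q y)) (cov : IsCoveringMap πE) (hopen : IsOpenMap πY)
    (inj : ∀ y y', πY y = πY y' → q y = q y' → y = y')
    (surj : ∀ x e, p x = πE e → ∃ y, πY y = x ∧ q y = e) :
    Y ≃ₜ {a : X × E // p a.1 = πE a.2} :=
  (Equiv.ofBijective (fun y => (⟨(πY y, q y), comm y⟩ : {a : X × E // p a.1 = πE a.2}))
    ⟨fun y y' h => inj y y' congr(($h).1.1) congr(($h).1.2), fun ⟨⟨x, e⟩, h⟩ => by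
      obtain ⟨y, rfl, rfl⟩ := surj x e h
      exact ⟨y, rfl⟩⟩).toHomeomorphOfContinuousOpen
    (Continuous.subtype_mk (by fun_prop) _) (fun U hU => by
      rw [isOpen_iff_mem_nhds]
      rintro _ ⟨y, hy, rfl⟩
      -- On `W` the point `e` is determined by its image in the base, so openness of the image only
      -- has to be checked in the `X` coordinate.
      obtain ⟨W, hW, hyW, hinj⟩ := cov.isLocalHomeomorph.isLocallyInjective (q y)
      have hN : IsOpen {a : {a : X × E // p a.1 = πE a.2} |
          a.1.1 ∈ πY '' (U ∩ q ⁻¹' W) ∧ a.1.2 ∈ W} :=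
        ((hopen _ (hU.inter (hW.preimage q.continuous))).preimage (by fun_prop)).inter
          (hW.preimage (by fun_prop))
      refine Filter.mem_of_superset (hN.mem_nhds ⟨⟨y, ⟨hy, hyW⟩, rfl⟩, hyW⟩) ?_
      rintro ⟨⟨_, e⟩, h⟩ ⟨⟨u, ⟨hu, huW⟩, rfl⟩, he⟩
      refine ⟨u, hu, Subtype.ext (Prod.ext rfl ?_)⟩
      exact hinj huW he ((comm u).symm.trans h))

/-- Let `Y` be the pullback of a covering map `E → B` along `p : X → B`. A contraction of `E` to `e₀`
fixing `e₀` makes `Y` homotopy equivalent to the homotopy fiber of `p`. -/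
theorem isHomotopyEquivalence_toHomotopyFiber (p : C(X, B)) (πE : C(E, B)) (πY : C(Y, X))
    (q : C(Y, E)) (comm : p.comp πY = πE.comp q) (cov : IsCoveringMap πE) (hopen : IsOpenMap πY)
    (inj : ∀ y y', πY y = πY y' → q y = q y' → y = y')
    (surj : ∀ x e, p x = πE e → ∃ y, πY y = x ∧ q y = e) (e₀ : E)
    (h : (ContinuousMap.id E).Homotopy (ContinuousMap.const E e₀)) (he₀ : ∀ s, h (s, e₀) = e₀) :
    ∃ H : (p.comp πY).Homotopy (ContinuousMap.const Y (πE e₀)),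
      IsHomotopyEquivalence (toHomotopyFiber πY p (πE e₀) H) := by
  have comm' : ∀ y, p (πY y) = πE (q y) := DFunLike.congr_fun comm
  let H : (p.comp πY).Homotopy (ContinuousMap.const Y (πE e₀)) :=
    { toFun := fun a => πE (h (a.1, q a.2))
      continuous_toFun := by fun_prop
      map_zero_left := fun y => by
        rw [h.apply_zero]; exact (comm' y).symm
      map_one_left := fun y => by rw [h.apply_one]; rfl }
  let θ := toHomotopyFiber πY p (πE e₀) H
  have hθ : ∀ y, (θ y).1.1 = πY y := fun _ => rfl
  have hθ' : ∀ y s, (θ y).1.2 s = πE (h (s, q y)) := fun _ _ => rfl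
  let P := HomotopyFiber p (πE e₀)
  let φ := pullbackHomeomorph p πE πY q comm' cov hopen inj surj
  -- Paths in the homotopy fiber end at `πE e₀`; reversed, they can all be lifted from the fixed
  -- point `e₀`. The end of the lift lies over `p x` and, together with `x`, gives the point of the
  -- pullback.
  let rev : C(I × P, B) := ⟨fun a => a.2.1.2 (σ a.1), by
    change Continuous fun a : I × {q : X × C(I, B) // q.2 0 = p q.1 ∧ q.2 1 = πE e₀} =>
      a.2.1.2 (σ a.1)
    fun_prop⟩
  have rev_zero : ∀ a : P, rev (0, a) = πE (ContinuousMap.const P e₀ a) := fun a => by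
    change a.1.2 (σ 0) = πE e₀
    rw [symm_zero, a.2.2]
  let Γ : C(I × P, E) := cov.liftHomotopy rev (ContinuousMap.const P e₀) rev_zero
  have hΓ : ∀ s a, πE (Γ (s, a)) = a.1.2 (σ s) := fun s a =>
    congr_fun (cov.liftHomotopy_lifts rev (ContinuousMap.const P e₀) rev_zero) (s, a)
  have hΓ0 : ∀ a, Γ (0, a) = e₀ := cov.liftHomotopy_zero rev (ContinuousMap.const P e₀) rev_zero
  have cfst : Continuous fun a : P => a.1.1 := by
    change Continuous fun a : {q : X × C(I, B) // q.2 0 = p q.1 ∧ q.2 1 = πE e₀} => a.1.1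
    fun_prop
  have hend : ∀ a : P, p a.1.1 = πE (Γ (1, a)) := fun a => by
    rw [hΓ, symm_one, a.2.1]
  let ψ : C(P, Y) := ⟨fun a => φ.symm ⟨(a.1.1, Γ (1, a)), hend a⟩, by fun_prop⟩
  have hψ : ∀ a, πY (ψ a) = a.1.1 ∧ q (ψ a) = Γ (1, a) := fun a => by
    have := φ.apply_symm_apply ⟨(a.1.1, Γ (1, a)), hend a⟩
    exact ⟨congr(($this).1.1), congr(($this).1.2)⟩
  have left : ψ.comp θ = ContinuousMap.id Y := by
    ext y
    refine inj _ _ (hψ (θ y)).1 ((hψ (θ y)).2.trans ?_)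
    -- The reversed contraction path of `q y` also lifts the reversed path of `θ y` from `e₀`, so
    -- uniqueness of lifts gives the same end point `q y`.
    have huniq := cov.eq_of_comp_eq (g₁ := fun s : I => Γ (s, θ y))
      (g₂ := fun s : I => h (σ s, q y)) (by fun_prop) (by fun_prop)
      (funext fun s => (hΓ s (θ y)).trans (hθ' y (σ s))) 0
      ((hΓ0 _).trans (by rw [symm_zero, h.apply_one]; rfl))
    refine (congr_fun huniq 1).trans ?_
    simp only [symm_one]
    exact h.apply_zero _
  -- The deformation from the given path (`m1 = 0`, `m2 = 1`) to the contraction path (`m1 = 1`, `m2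
  -- = 0`) first turns on `h` and then turns off motion along the lift. One parameter is always `1`,
  -- so the end stays at `πE e₀`: either `h` is complete, or the lift has reached `e₀`, which `h`
  -- fixes.
  let m1 (s : I) : I := ⟨min (2 * s) 1, le_min (by linarith [s.2.1]) zero_le_one, min_le_right _ _⟩
  let m2 (s : I) : I := ⟨min (2 - 2 * s) 1, le_min (by linarith [s.2.2]) zero_le_one,
    min_le_right _ _⟩
  have cm1 : Continuous m1 := by fun_prop
  have cm2 : Continuous m2 := by fun_prop
  have hm : ∀ s, m1 s = 1 ∨ m2 s = 1 := fun s => by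
    rcases le_total (1 : ℝ) (2 * s) with h1 | h1
    · exact Or.inl (Subtype.ext (min_eq_right h1))
    · exact Or.inr (Subtype.ext (min_eq_right (by linarith)))
  let K : C((I × P) × I, B) := ⟨fun a => πE (h (a.2 * m1 a.1.1, Γ (σ (a.2 * m2 a.1.1), a.1.2))),
    by fun_prop⟩
  have hK : ∀ s a u, K ((s, a), u) = πE (h (u * m1 s, Γ (σ (u * m2 s), a))) := fun _ _ _ => rfl
  let L : C(I × P, P) :=
    { toFun := fun a => ⟨(a.2.1.1, K.curry a), by
        change K (a, 0) = _
        rw [hK, zero_mul, zero_mul, symm_zero, h.apply_zero]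
        exact (hend a.2).symm, by
        change K (a, 1) = _
        rw [hK, one_mul, one_mul]
        rcases hm a.1 with h1 | h1
        · rw [h1, h.apply_one]; rfl
        · rw [h1, symm_one, hΓ0, he₀]⟩
      continuous_toFun := Continuous.subtype_mk
        ((cfst.comp continuous_snd).prodMk K.curry.continuous) _ }
  have right : (θ.comp ψ).Homotopic (ContinuousMap.id P) := by
    refine ContinuousMap.Homotopic.symm ⟨{ toContinuousMap := L, map_zero_left := fun a => ?_,
                                           map_one_left := fun a => ?_ }⟩
    · refine Subtype.ext (Prod.ext rfl (ContinuousMap.ext fun u => ?_))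
      change K ((0, a), u) = a.1.2 u
      have h1 : m1 0 = 0 := Subtype.ext (by simp [m1])
      have h2 : m2 0 = 1 := Subtype.ext (by simp [m2])
      rw [hK, h1, h2, mul_zero, mul_one, h.apply_zero]
      refine (hΓ _ _).trans ?_
      rw [symm_symm]
    · refine Subtype.ext (Prod.ext (hψ a).1.symm (ContinuousMap.ext fun u => ?_))
      change K ((1, a), u) = (θ (ψ a)).1.2 u
      have h1 : m1 1 = 1 := Subtype.ext (by simp [m1])
      have h2 : m2 1 = 0 := Subtype.ext (by simp [m2])
      rw [hK, h1, h2, mul_zero, mul_one, symm_zero, hθ', (hψ a).2]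
  exact ⟨H, ⟨θ, ψ, left ▸ ContinuousMap.Homotopic.refl _, right⟩, rfl⟩

/-- Restricting the homotopy along `j` makes the new comparison map the composite of `j` with the
old one. -/
theorem IsHomotopyEquivalence.toHomotopyFiber_comp {A : Type*} [TopologicalSpace A] {p : C(X, B)}
    {i : C(Y, X)} {b : B} (j : C(A, Y)) (hj : IsHomotopyEquivalence j)
    (h : IsHomotopyFiberSequence i p b) : IsHomotopyFiberSequence (i.comp j) p b := by
  obtain ⟨H, e, he⟩ := h
  obtain ⟨e', rfl⟩ := hj
  refine ⟨(H.compContinuousMap e'.toFun).cast rfl rfl, e'.trans e, ?_⟩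
  exact ContinuousMap.ext fun a => DFunLike.congr_fun he (e'.toFun a)

end CoveringFiber

/-! ### The fiber sequence of a functor to a connected groupoid -/

section FiberSequence

universe u

variable {C D G : Type u} [SmallCategory C] [SmallCategory D] [Groupoid.{u} G]

theorem classifyingMap_vertex (F : C ⥤ D) (X : C) :
    classifyingMap F (vertex X) = vertex (F.obj X) := by
  rw [vertex_eq_cell X default, vertex_eq_cell (F.obj X) default, classifyingMap_cell]
  exact congrArg (fun τ => cell τ default) (ComposableArrows.ext₀ rfl)

theorem classifyingMap_const (Y : D) :
    classifyingMap ((Functor.const C).obj Y) = ContinuousMap.const _ (vertex Y) :=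
  continuousMap_ext_cell fun n σ t => by
    rw [classifyingMap_cell, ContinuousMap.const_apply,
      vertex_eq_cell Y (stdSimplex.map (OrderHom.const (Fin (n + 1)) (0 : Fin 1)) t), cell_map]
    rfl

/-- The natural transformation from the constant functor at the initial object `𝟙 Z` of the category
of arrows out of `Z`. -/
def arrowFromId (Z : G) : (Functor.const (StructuredArrow Z (𝟭 G))).obj
    (StructuredArrow.mk (T := 𝟭 G) (𝟙 Z)) ⟶ 𝟭 (StructuredArrow Z (𝟭 G)) where
  app X := StructuredArrow.homMk X.hom (Category.id_comp _)
  naturality X Y f := by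
    ext
    exact (Category.id_comp _).trans (StructuredArrow.w f).symm

/-- A contraction of the classifying space of the category of arrows out of `Z`. -/
noncomputable def arrowContraction (Z : G) :
    (ContinuousMap.id (classifyingSpace (StructuredArrow Z (𝟭 G)))).Homotopy
      (ContinuousMap.const _ (vertex (StructuredArrow.mk (T := 𝟭 G) (𝟙 Z)))) :=
  ((natTransHomotopy (arrowFromId Z)).cast (classifyingMap_const _) classifyingMap_id).symm

theorem arrowContraction_vertex (Z : G) (s : unitInterval) :
    arrowContraction Z (s, vertex (StructuredArrow.mk (T := 𝟭 G) (𝟙 Z))) =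
      vertex (StructuredArrow.mk (T := 𝟭 G) (𝟙 Z)) := by
  have h := natTransHomotopy_vertex (arrowFromId Z) (StructuredArrow.mk (T := 𝟭 G) (𝟙 Z)) rfl rfl
    (unitInterval.symm s)
  rw [arrowContraction, ContinuousMap.Homotopy.symm_apply]
  exact h

/-- The functor from the fiber category of `F` to the category of arrows out of `Z`. -/
def fiberToArrow (Z : G) (F : C ⥤ G) : StructuredArrow Z F ⥤ StructuredArrow Z (𝟭 G) :=
  fiberLift (StructuredArrow.proj Z F ⋙ F) (fun X => X.hom) fun h => StructuredArrow.w h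

theorem fiberToArrow_smul {Z : G} {F : C ⥤ G} (g : Aut Z)
    (x : classifyingSpace (StructuredArrow Z F)) :
    classifyingMap (fiberToArrow Z F) (g • x) = g • classifyingMap (fiberToArrow Z F) x := by
  rw [smul_def, smul_def, ← ContinuousMap.comp_apply, ← ContinuousMap.comp_apply,
    ← classifyingMap_comp, ← classifyingMap_comp]
  rfl

/-- A functor `F` to a connected groupoid induces a homotopy fiber sequence. -/
theorem isHomotopyFiberSequence_fiberProj (F : C ⥤ G) (Z : G) (hZ : ∀ X : G, Nonempty (Z ⟶ X)) :
    IsHomotopyFiberSequence (fiberProj Z F) (classifyingMap F) (vertex Z) := by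
  have hE := isQuotientCoveringMap_fiberProj (F := 𝟭 G) hZ
  have hY := isQuotientCoveringMap_fiberProj (F := F) hZ
  have comm : (classifyingMap F).comp (fiberProj Z F) =
      (fiberProj Z (𝟭 G)).comp (classifyingMap (fiberToArrow Z F)) := by
    rw [← classifyingMap_comp, ← classifyingMap_comp]
    rfl
  have := isHomotopyEquivalence_toHomotopyFiber (classifyingMap F) (fiberProj Z (𝟭 G))
    (fiberProj Z F) (classifyingMap (fiberToArrow Z F)) comm hE.isCoveringMap
    hY.isCoveringMap.isOpenMap ?_ ?_ _ (arrowContraction Z) (arrowContraction_vertex Z)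
  · rwa [classifyingMap_vertex] at this
  · intro y y' h1 h2
    obtain ⟨g, rfl⟩ := hY.apply_eq_iff_mem_orbit.1 h1
    have := hE.isCancelSMul
    -- Points over the same base point differ by some `g`; if their images agree, `g` fixes a point
    -- of the free action upstairs.
    have hg : g = 1 := by
      refine IsCancelSMul.right_cancel g 1 (classifyingMap (fiberToArrow Z F) y') ?_
      rw [one_smul, ← fiberToArrow_smul]
      exact h2
    subst hg
    exact one_smul _ y'
  · intro x e h
    obtain ⟨y, rfl⟩ := fiberProj_surjective (F := F) hZ x
    -- Any lift `y` of `x` has the right image up to a group element, and translating `y` by it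
    -- corrects the image by equivariance.
    obtain ⟨g, hg⟩ := hE.apply_eq_iff_mem_orbit.1
      (h.symm.trans (DFunLike.congr_fun comm y))
    exact ⟨g • y, fiberProj_smul g y, (fiberToArrow_smul g y).trans hg⟩

end FiberSequence

/-! ### Representations and homology -/

section Vectors

variable {E E' : Type} {K : Type} [Field K] {V : Type} [AddCommGroup V] [Module K V]

theorem linearIndepOn_comp_iff_injOn (ρ : E → V) (φ : E' → E) (I : Set E') :
    LinearIndepOn K (ρ ∘ φ) I ↔ Set.InjOn φ I ∧ LinearIndepOn K ρ (φ '' I) :=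
  ⟨fun h => ⟨fun _ hx _ hy hxy => h.injOn hx hy (congrArg ρ hxy), h.image_of_comp _ _⟩,
    fun h => h.2.comp_of_image h.1⟩

/-- The spanning condition is met by shrinking the target to the span, which does not affect linear
independence. -/
theorem IsRepresentable.of_indep {M : Matroid E} {ρ : E → V}
    (h : ∀ I : Set E, M.Indep I ↔ LinearIndepOn K ρ I) : IsRepresentable K M := by
  refine ⟨Submodule.span K (Set.range ρ), inferInstance, inferInstance,
    fun e => ⟨ρ e, Submodule.subset_span ⟨e, rfl⟩⟩, fun I => ?_, ?_⟩
  · rw [h]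
    exact LinearMap.linearIndepOn_iff_of_injOn (Submodule.subtype (Submodule.span K (Set.range ρ)))
      (v := fun e => (⟨ρ e, Submodule.subset_span ⟨e, rfl⟩⟩ : Submodule.span K (Set.range ρ)))
      (Submodule.subtype_injective _).injOn
  · rw [← Submodule.map_injective_of_injective (Submodule.subtype_injective _) |>.eq_iff,
      Submodule.map_span, ← Set.range_comp, Submodule.map_top, Submodule.range_subtype]
    rfl

/-- A matroid obtained from a regular one by deleting elements and adding parallel elements is
regular. -/
theorem IsRegular.of_comap {M : Matroid E} (hM : IsRegular M) {M' : Matroid E'} (φ : E' → E)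
    (h : ∀ I, M'.Indep I ↔ Set.InjOn φ I ∧ M.Indep (φ '' I)) : IsRegular M' := by
  intro K _
  obtain ⟨V, _, _, ρ, hρ, -⟩ := hM K
  refine IsRepresentable.of_indep (ρ := ρ ∘ φ) fun I => ?_
  rw [h, hρ, linearIndepOn_comp_iff_injOn]

theorem eRank_linearMatroid [Finite E] (ρ : E → V) :
    (linearMatroid K ρ).eRank = Module.finrank K (Submodule.span K (Set.range ρ)) := by
  obtain ⟨B, hB⟩ := (linearMatroid K ρ).exists_isBase
  have hli : LinearIndepOn K ρ B := hB.indep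
  have hspan : Submodule.span K (Set.range ρ) = Submodule.span K (ρ '' B) := by
    refine le_antisymm (Submodule.span_le.2 ?_) (Submodule.span_mono (Set.image_subset_range _ _))
    rintro _ ⟨e, rfl⟩
    by_contra hns
    have he : e ∉ B := fun he => hns (Submodule.subset_span ⟨e, he, rfl⟩)
    have : (linearMatroid K ρ).Indep (insert e B) := hli.insert hns
    exact he (hB.eq_of_subset_indep this (Set.subset_insert _ _) ▸ Set.mem_insert e B)
  have := Fintype.ofFinite B
  rw [hspan, Set.image_eq_range, finrank_span_eq_card hli, ← hB.encard_eq_eRank,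
    ← (Set.toFinite B).cast_ncard_eq, ← Nat.card_coe_set_eq, Nat.card_eq_fintype_card]

theorem eRank_linearMatroid_eq_iff {r : ℕ} [Finite E] (ρ : E → Fin r → ZMod 2) :
    (linearMatroid (ZMod 2) ρ).eRank = r ↔ Submodule.span (ZMod 2) (Set.range ρ) = ⊤ := by
  rw [eRank_linearMatroid, Nat.cast_inj]
  constructor
  · intro h
    exact Submodule.eq_top_of_finrank_eq (by rw [h, Module.finrank_fin_fun])
  · intro h
    rw [h, finrank_top, Module.finrank_fin_fun]

/-- An independent set lies in a base, whose classes are independent because they are so in some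
binary representation. A dependent set contains a circuit, whose sum is a nontrivial relation. -/
theorem H1F2.indep_iff {r : ℕ} (A : RegularMatroid r) (I : Set A.E) :
    A.M.Indep I ↔ LinearIndepOn (ZMod 2) (H1F2.of A.M) I := by
  classical
  constructor
  · intro h
    obtain ⟨B, hB, hIB⟩ := h.exists_isBase_superset
    exact (H1F2.linearIndepOn_base (A.regular (ZMod 2)) hB).mono hIB
  · intro h
    by_contra hI
    have hdep : A.M.Dep I := ⟨hI, by rw [A.ground]; exact Set.subset_univ _⟩
    obtain ⟨C, hCI, hC⟩ := hdep.exists_isCircuit_subset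
    lift C to Finset A.E using Set.toFinite C
    have h1 := linearIndepOn_finset_iff.1 (h.mono hCI) (fun _ => 1)
      (by simpa using H1F2.sum_circuit hC)
    obtain ⟨e, he⟩ := hC.nonempty
    exact one_ne_zero (h1 e he)

/-- A surjection between spaces of the same dimension `r`. -/
theorem H1F2.lift_bijective {r : ℕ} (A : RegularMatroid r) (ρ : A.E → Fin r → ZMod 2)
    (hρ : ∀ C : Finset A.E, A.M.IsCircuit (C : Set A.E) → ∑ e ∈ C, ρ e = 0)
    (hspan : Submodule.span (ZMod 2) (Set.range ρ) = ⊤) :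
    Function.Bijective (H1F2.lift A.M ρ hρ) := by
  obtain ⟨eA⟩ := H1F2.nonempty_equiv A
  have hsurj : Function.Surjective (H1F2.lift A.M ρ hρ) := by
    rw [← LinearMap.range_eq_top, eq_top_iff, ← hspan, Submodule.span_le]
    rintro _ ⟨e, rfl⟩
    exact ⟨H1F2.of A.M e, H1F2.lift_of _ _ _ _⟩
  have : Module.Finite (ZMod 2) (H1F2 A.M) := Module.Finite.equiv eA.symm
  refine ⟨?_, hsurj⟩
  rwa [LinearMap.injective_iff_surjective_of_finrank_eq_finrank eA.finrank_eq]

end Vectors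

/-! ### The fiber category as vector configurations -/

namespace FiberCategory

variable {r : ℕ} {Z : GL2 r}

/-- Coordinates on `Z`. -/
noncomputable def coord (Z : GL2 r) : Z.V ≃ₗ[ZMod 2] (Fin r → ZMod 2) := Z.nonempty_equiv.some

/-- The structure isomorphism of an object of the fiber category. -/
noncomputable def iso (X : FiberCategory r Z) : Z.V ≃ₗ[ZMod 2] H1F2 X.right.M := GL2.Hom.toEquiv X.hom

/-- The vector configuration of an object of the fiber category. -/
noncomputable def vec (X : FiberCategory r Z) (e : X.right.E) : Fin r → ZMod 2 :=
  coord Z ((iso X).symm (H1F2.of X.right.M e))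

theorem indep_iff (X : FiberCategory r Z) (I : Set X.right.E) :
    X.right.M.Indep I ↔ LinearIndepOn (ZMod 2) (vec X) I := by
  rw [H1F2.indep_iff]
  exact (LinearMap.linearIndepOn_iff_of_injOn ((iso X).symm.trans (coord Z)).toLinearMap
    ((iso X).symm.trans (coord Z)).injective.injOn).symm

theorem span_vec (X : FiberCategory r Z) :
    Submodule.span (ZMod 2) (Set.range (vec X)) = ⊤ := by
  have h := congrArg (Submodule.map ((iso X).symm.trans (coord Z)).toLinearMap)
    (H1F2.span_of X.right.M)
  rw [Submodule.map_span, ← Set.range_comp, Submodule.map_top, LinearEquiv.range] at h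
  exact h

theorem vec_map {X Y : FiberCategory r Z} (f : X ⟶ Y) (e : X.right.E) :
    vec Y (f.right.toFun e) = vec X e := by
  have hw : ∀ z, H1F2.map f.right (iso X z) = iso Y z := fun z =>
    congrArg (fun h : GL2.Hom Z _ => h.toEquiv z) (StructuredArrow.w f)
  unfold vec
  congr 1
  rw [LinearEquiv.symm_apply_eq, ← hw, LinearEquiv.apply_symm_apply, H1F2.map_of]

theorem hom_ext {X Y : FiberCategory r Z} {f g : X ⟶ Y} (h : f.right.toFun = g.right.toFun) :
    f = g :=
  StructuredArrow.hom_ext _ _ (RegularMatroid.Hom.ext h)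

/-- An injection compatible with the vector configurations is a morphism of matroids. -/
def matroidHom {X Y : FiberCategory r Z} (h : X.right.E → Y.right.E) (hinj : Function.Injective h)
    (hvec : ∀ e, vec Y (h e) = vec X e) : X.right ⟶ Y.right :=
  (⟨h, hinj, fun I => by
    rw [indep_iff, indep_iff, ← linearIndepOn_comp_iff hinj]
    exact iff_of_eq (congrArg (LinearIndepOn (ZMod 2) · I) (funext fun e => (hvec e).symm))⟩ :
    RegularMatroid.Hom X.right Y.right)

theorem map_matroidHom {X Y : FiberCategory r Z} (h : X.right.E → Y.right.E)
    (hinj : Function.Injective h) (hvec : ∀ e, vec Y (h e) = vec X e) (z : Z.V) :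
    H1F2.map (matroidHom h hinj hvec) (iso X z) = iso Y z := by
  have key : H1F2.map (matroidHom h hinj hvec) = ((iso X).symm.trans (iso Y)).toLinearMap := by
    refine LinearMap.ext_on_range (H1F2.span_of X.right.M) fun e => ?_
    rw [H1F2.map_of]
    exact ((iso Y).symm_apply_eq).1 ((coord Z).injective (hvec e))
  rw [key]
  simp

/-- An injection compatible with the vector configurations is a morphism of the fiber category. -/
noncomputable def homMk {X Y : FiberCategory r Z} (h : X.right.E → Y.right.E)
    (hinj : Function.Injective h) (hvec : ∀ e, vec Y (h e) = vec X e) : X ⟶ Y :=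
  StructuredArrow.homMk (matroidHom h hinj hvec)
    (GL2.Hom.ext (LinearEquiv.ext (map_matroidHom h hinj hvec)))

/-- The isomorphism from homology given by a representation. -/
noncomputable def homologyEquiv (A : RegularMatroid r) (ρ : A.E → Fin r → ZMod 2)
    (hρ : IsRepresentation (ZMod 2) A.M ρ) : H1F2 A.M ≃ₗ[ZMod 2] (Fin r → ZMod 2) :=
  LinearEquiv.ofBijective _
    (H1F2.lift_bijective A ρ (fun _ hC => sum_circuit_representation hρ.1 hC) hρ.2)

theorem homologyEquiv_of (A : RegularMatroid r) (ρ : A.E → Fin r → ZMod 2)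
    (hρ : IsRepresentation (ZMod 2) A.M ρ) (e : A.E) :
    homologyEquiv A ρ hρ (H1F2.of A.M e) = ρ e :=
  H1F2.lift_of A.M ρ (fun _ hC => sum_circuit_representation hρ.1 hC) e

/-- The object of the fiber category given by a representation. -/
noncomputable def mk (Z : GL2 r) (A : RegularMatroid r) (ρ : A.E → Fin r → ZMod 2)
    (hρ : IsRepresentation (ZMod 2) A.M ρ) : FiberCategory r Z :=
  StructuredArrow.mk (Y := A) (⟨(coord Z).trans (homologyEquiv A ρ hρ).symm⟩ :
    GL2.Hom Z ((homologyFunctor r).obj A))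

theorem vec_mk (A : RegularMatroid r) (ρ : A.E → Fin r → ZMod 2)
    (hρ : IsRepresentation (ZMod 2) A.M ρ) (e : A.E) : vec (mk Z A ρ hρ) e = ρ e :=
  ((coord Z).apply_symm_apply _).trans (homologyEquiv_of A ρ hρ e)

/-- The nonzero vectors of the configuration of an object of the fiber category. -/
def support (X : FiberCategory r Z) : Set (Fin r → ZMod 2) := Set.range (vec X) \ {0}

theorem span_support (X : FiberCategory r Z) : Submodule.span (ZMod 2) (support X) = ⊤ := by
  rw [support, Submodule.span_sdiff_singleton_zero, span_vec]

/-- A family of vectors factoring through the vectors of an object of the fiber category defines a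
regular matroid. -/
theorem isRegular_linearMatroid (X : FiberCategory r Z) {E : Type} [Finite E]
    (ρ : E → Fin r → ZMod 2) (h : ∀ e, ρ e ∈ Set.range (vec X)) :
    IsRegular (linearMatroid (ZMod 2) ρ) := by
  -- Choosing an element with each given vector exhibits the new matroid as a pullback of the
  -- regular one along `φ`, where elements with equal images are parallel or loops.
  choose φ hφ using h
  obtain rfl : vec X ∘ φ = ρ := funext hφ
  refine (X.right.regular).of_comap φ fun I => ?_
  rw [linearMatroid_indep, linearIndepOn_comp_iff_injOn, indep_iff]

/-- The matroid of an object of the fiber category together with a parallel copy of every nonzero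
vector. -/
noncomputable def thicken (X : FiberCategory r Z) : RegularMatroid r where
  E := X.right.E ⊕ support X
  finite := inferInstance
  M := linearMatroid (ZMod 2) (Sum.elim (vec X) Subtype.val)
  ground := rfl
  rank := (eRank_linearMatroid_eq_iff _).2 (by
    rw [Set.Sum.elim_range, Submodule.span_union, span_vec, top_sup_eq])
  regular := isRegular_linearMatroid X _ (by
    rintro (e | s)
    · exact ⟨e, rfl⟩
    · exact s.2.1)

/-- The object of the fiber category defined by `thicken`. -/
noncomputable def thickenObj (X : FiberCategory r Z) : FiberCategory r Z :=
  mk Z (thicken X) (Sum.elim (vec X) Subtype.val) ⟨fun _ => Iff.rfl,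
    (eRank_linearMatroid_eq_iff _).1 (thicken X).rank⟩

theorem vec_thickenObj (X : FiberCategory r Z) (e : X.right.E ⊕ support X) :
    vec (thickenObj X) e = Sum.elim (vec X) Subtype.val e := vec_mk _ _ _ _

theorem support_mono {X Y : FiberCategory r Z} (f : X ⟶ Y) : support X ⊆ support Y := by
  rintro _ ⟨⟨e, rfl⟩, h⟩
  exact ⟨⟨f.right.toFun e, vec_map f e⟩, h⟩

/-- The functor adding to a matroid a parallel copy of every nonzero vector. -/
noncomputable def thickenFunctor (Z : GL2 r) : FiberCategory r Z ⥤ FiberCategory r Z where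
  obj := thickenObj
  map {X Y} f := homMk (X := thickenObj X) (Y := thickenObj Y)
    (Sum.map f.right.toFun (Set.inclusion (support_mono f)))
    (f.right.injective.sumMap (Set.inclusion_injective _)) (by
      intro e
      refine (vec_thickenObj Y _).trans (Eq.trans ?_ (vec_thickenObj X e).symm)
      rcases e with e | s
      · exact vec_map f e
      · rfl)
  map_id X := hom_ext (by
    funext e
    rcases e with e | s <;> rfl)
  map_comp f g := hom_ext (by
    funext e
    rcases e with e | s <;> rfl)

/-- A matroid is contained in its thickening. -/
noncomputable def toThicken (Z : GL2 r) : 𝟭 (FiberCategory r Z) ⟶ thickenFunctor Z where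
  app X := homMk (X := X) (Y := thickenObj X) Sum.inl Sum.inl_injective
    fun e => vec_thickenObj X (Sum.inl e)
  naturality _ _ _ := hom_ext rfl

/-- The functor sending an object of the fiber category to its set of nonzero vectors. -/
noncomputable def supportFunctor (Z : GL2 r) : FiberCategory r Z ⥤ IR r where
  obj X :=
    { carrier := support X
      zero_notMem := fun h => h.2 rfl
      rank := (eRank_linearMatroid_eq_iff _).2 (by rw [Subtype.range_coe, span_support])
      regular := isRegular_linearMatroid X _ fun s => s.2.1 }
  map f := homOfLE (support_mono f)

theorem isRepresentation_toRegularMatroid (S : IR r) :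
    IsRepresentation (ZMod 2) S.toRegularMatroid.M
      (Subtype.val : S.carrier → Fin r → ZMod 2) :=
  ⟨fun _ => Iff.rfl, (eRank_linearMatroid_eq_iff _).1 S.rank⟩

/-- The object of the fiber category given by a set of vectors. -/
noncomputable def ofIRObj (Z : GL2 r) (S : IR r) : FiberCategory r Z :=
  mk Z S.toRegularMatroid Subtype.val (isRepresentation_toRegularMatroid S)

theorem vec_ofIRObj (S : IR r) (s : S.carrier) : vec (ofIRObj Z S) s = s.val := vec_mk _ _ _ _

/-- The functor sending a set of vectors to the corresponding object of the fiber category. -/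
noncomputable def ofIR (Z : GL2 r) : IR r ⥤ FiberCategory r Z where
  obj := ofIRObj Z
  map {S T} h := homMk (X := ofIRObj Z S) (Y := ofIRObj Z T)
    (Set.inclusion (show S.carrier ⊆ T.carrier from (leOfHom h : S ≤ T)))
    (Set.inclusion_injective _)
    fun s => (vec_ofIRObj T _).trans (vec_ofIRObj S s).symm
  map_id _ := hom_ext rfl
  map_comp _ _ := hom_ext rfl

/-- This strict equality turns the fiber sequence of the projection, precomposed with `ofIR`, into
the one for `IR.inclusionFunctor`. -/
theorem ofIR_proj (Z : GL2 r) :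
    ofIR Z ⋙ StructuredArrow.proj Z (homologyFunctor r) = IR.inclusionFunctor r := rfl

/-- The nonzero vectors of a matroid are contained in its thickening. -/
noncomputable def supportToThicken (Z : GL2 r) : supportFunctor Z ⋙ ofIR Z ⟶ thickenFunctor Z where
  app X := homMk (X := ofIRObj Z ((supportFunctor Z).obj X)) (Y := thickenObj X)
    Sum.inr Sum.inr_injective
    fun s => (vec_thickenObj X (Sum.inr s)).trans
      (vec_ofIRObj ((supportFunctor Z).obj X) s).symm
  naturality _ _ _ := hom_ext rfl

/-- A set of nonzero vectors is recovered from its matroid. -/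
noncomputable def supportOfIR (Z : GL2 r) : ofIR Z ⋙ supportFunctor Z ⟶ 𝟭 (IR r) where
  app S := homOfLE (by
    rintro _ ⟨⟨s, rfl⟩, -⟩
    change vec (ofIRObj Z S) s ∈ S.carrier
    rw [vec_ofIRObj S s]
    exact s.2)

theorem isHomotopyEquivalence_ofIR (Z : GL2 r) :
    IsHomotopyEquivalence (classifyingMap (ofIR Z)) := by
  refine ⟨⟨classifyingMap (ofIR Z), classifyingMap (supportFunctor Z), ?_, ?_⟩, rfl⟩
  · rw [← classifyingMap_comp, ← classifyingMap_id]
    exact homotopic_of_natTrans (supportOfIR Z)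
  · rw [← classifyingMap_comp, ← classifyingMap_id]
    -- A direct map to the support would not be injective on parallel elements, and one from the
    -- support would need a choice among them; hence the zigzag through the thickening.
    exact (homotopic_of_natTrans (supportToThicken Z)).trans
      (homotopic_of_natTrans (toThicken Z)).symm

end FiberCategory

/-! ### Connectedness of the groupoid and conclusion -/

theorem GL2.nonempty_hom {r : ℕ} (Z X : GL2 r) : Nonempty (Z ⟶ X) :=
  ⟨(⟨Z.nonempty_equiv.some.trans X.nonempty_equiv.some.symm⟩ : GL2.Hom Z X)⟩

end RegMatroid

theorem mainTheorem11 (r : ℕ) (hr : 1 ≤ r) (Z : GL2 r) :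
    Nonempty (ContinuousMap.HomotopyEquiv
      (classifyingSpace (IR r)) (classifyingSpace (FiberCategory r Z))) ∧
    IsHomotopyFiberSequence
      (classifyingMap (IR.inclusionFunctor r))
      (classifyingMap (homologyFunctor r))
      (vertex Z) := by
  obtain ⟨e, he⟩ := FiberCategory.isHomotopyEquivalence_ofIR Z
  refine ⟨⟨e⟩, ?_⟩
  have := IsHomotopyEquivalence.toHomotopyFiber_comp _ ⟨e, he⟩
    (isHomotopyFiberSequence_fiberProj (homologyFunctor r) Z (GL2.nonempty_hom Z))
  rwa [← classifyingMap_comp, FiberCategory.ofIR_proj] at this
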